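/- Let $(X,\mathcal B)$ be a measurable space with countably generated $\sigma$-algebra. For $i=1,2$ let $m^i=(m^i_x)_{x\in X}$ be a random walk on $X$ (a family of probability measures on $\mathcal B$ such that $x\mapsto m^i_x(B)$ is measurable for every $B\in\mathcal B$) and let $\nu_i$ be a $\sigma$-finite measure on $X$ that is reversible, and hence invariant, with respect to $m^i$, i.e. $dm^i_x(y)\,d\nu_i(x)=dm^i_y(x)\,d\nu_i(y)$. Assume that $\nu_2\ll\nu_1$, that $\mu:=\frac{d\nu_2}{d\nu_1}\in L^\infty(X,\nu_1)$ and that there is $c>0$ with $\mu\ge c$ $\nu_1$-a.e. Put $H:=L^2(X,\nu_1)$. Write $\nabla u(x,y)=u(y)-u(x)$ and ${\rm div}_m{\bf z}(x)=\frac12\int_X({\bf z}(x,y)-{\bf z}(y,x))\,dm_x(y)$. For $r>1$ and $(m,\nu)=(m^i,\nu_i)$ let $$\mathcal F_{r,m}(u)=\frac1{2r}\int_X\int_X|u(y)-u(x)|^r\,dm_x(y)\,d\nu(x)\in[0,+\infty],\qquad u\in H,$$ and let $\Delta_r^m$ be the operator in $L^2(X,\nu)$ consisting of all pairs $(u,v)$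 with $u,v\in L^2(X,\nu)$, $\nabla u\in L^r(X\times X,\nu\otimes m_x)$ and $v={\rm div}_m(|\nabla u|^{r-2}\nabla u)$ $\nu$-a.e. For $F:H\to(-\infty,+\infty]$, $v\in\partial_HF(u)$ means that $F(u)<\infty$ and $F(w)-F(u)\ge(v,w-u)_H$ for all $w\in H$. An operator $A\subset H\times H$ is completely accretive if for all $(u_1,v_1),(u_2,v_2)\in A$, all $\lambda>0$ and all convex, lower semicontinuous $j:\mathbb R\to[0,+\infty]$ with $j(0)=0$, $$\int_Xj(u_1-u_2)\,d\nu_1\le\int_Xj\big(u_1-u_2+\lambda(v_1-v_2)\big)\,d\nu_1 .$$ Let $p,q>1$ and suppose that one of the following conditions holds: (a) $\nu_1(X)<\infty$ and $q\le2$; (b) $\nu_1(X)=+\infty$ and $q\le\frac p{p-1}\le2\le p$. Then $$\partial_H\big(\mathcal F_{q,m^1}+\mathcal F_{p,m^2}\big)=-\Delta_q^{m^1}-\mu\,\Delta_p^{m^2},$$ where the right-hand side is the operator in $H$ consisting of all $(u,v)\in H\times H$ such that $v=-v_1-\mu v_2$ $\nu_1$-a.e. for some $(u,v_1)\in\Delta_q^{m^1}$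 and $(u,v_2)\in\Delta_p^{m^2}$. Moreover, this operator is completely accretive and its domain is dense in $H$. -/

import Mathlib

open MeasureTheory ProbabilityTheory
open scoped NNReal ENNReal

namespace RandomWalk

noncomputable section

/-! ### Convex analysis in a Hilbert space -/

/-- The subdifferential of `F : H → (-∞, ∞]`, as a multivalued operator on `H`, identified with
its graph: `(u, v)` belongs to it iff `F u < ∞` and `F u + ⟨v, w - u⟩ ≤ F w` for all `w`. -/
def subdifferential {H : Type*} [NormedAddCommGroup H] [InnerProductSpace ℝ H]
    (F : H → EReal) : Set (H × H) :=
  {a | F a.1 ≠ ⊤ ∧ ∀ w : H, F a.1 + ((inner ℝ a.2 (w - a.1) : ℝ) : EReal) ≤ F w}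

/-- The domain of a multivalued operator. -/
def operatorDomain {H : Type*} (A : Set (H × H)) : Set H :=
  {u | ∃ v, (u, v) ∈ A}

/-! ### Complete accretivity -/

/-- The class `J₀` of convex, lower semicontinuous functions `j : ℝ → [0, ∞]` with `j 0 = 0`. -/
def JZero : Set (ℝ → ℝ≥0∞) :=
  {j | ConvexOn ℝ≥0 Set.univ j ∧ LowerSemicontinuous j ∧ j 0 = 0}

/-- The relation `u ≪ v`: `∫ j(u) dν ≤ ∫ j(v) dν` for all `j ∈ J₀`. -/
def JDominated {X : Type*} [MeasurableSpace X] (ν : Measure X) (u v : X → ℝ) : Prop :=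
  ∀ j ∈ JZero, ∫⁻ x, j (u x) ∂ν ≤ ∫⁻ x, j (v x) ∂ν

/-- Complete accretivity of an operator in `L²(X, ν)`. -/
def CompletelyAccretive {X : Type*} [MeasurableSpace X] {ν : Measure X}
    (A : Set (Lp ℝ 2 ν × Lp ℝ 2 ν)) : Prop :=
  ∀ a ∈ A, ∀ b ∈ A, ∀ r : ℝ, 0 < r →
    JDominated ν (a.1 - b.1 : Lp ℝ 2 ν) (a.1 - b.1 + r • (a.2 - b.2) : Lp ℝ 2 ν)

/-! ### Nonlocal operators on a random walk space -/

/-- The nonlocal gradient `∇u(x, y) = u(y) - u(x)`. -/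
def nonlocalGrad {X : Type*} (u : X → ℝ) : X × X → ℝ :=
  fun z => u z.2 - u z.1

/-- The `m`-divergence `(div_m z)(x) = ½ ∫ (z(x, y) - z(y, x)) dm_x(y)`. -/
def nonlocalDiv {X : Type*} [MeasurableSpace X] (m : Kernel X X) (z : X × X → ℝ) : X → ℝ :=
  fun x => (1 / 2 : ℝ) * ∫ y, (z (x, y) - z (y, x)) ∂(m x)

/-- The flux `|∇u|^(p-2) ∇u`. For `p > 1` it vanishes where `∇u` does. -/
def pFlux {X : Type*} (p : ℝ) (u : X → ℝ) : X × X → ℝ :=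
  fun z => |nonlocalGrad u z| ^ (p - 2) * nonlocalGrad u z

/-- The energy `1/(2p) ∬ |u(y) - u(x)|^p d(ν ⊗ m_x)(x, y)`, with value `+∞` when the integral
is infinite, i.e. when `|∇u|^p` is not integrable. -/
def pEnergy {X : Type*} [MeasurableSpace X] (p : ℝ) (m : Kernel X X) (ν : Measure X)
    (u : X → ℝ) : EReal :=
  ((ENNReal.ofReal (1 / (2 * p)) *
    ∫⁻ z, ENNReal.ofReal (|nonlocalGrad u z| ^ p) ∂(ν ⊗ₘ m) : ℝ≥0∞) : EReal)

/-- The `m`-`p`-Laplacian, as an operator in `L²(X, ν)`. -/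
def pLaplacian {X : Type*} [MeasurableSpace X] (p : ℝ) (m : Kernel X X) (ν : Measure X) :
    Set (Lp ℝ 2 ν × Lp ℝ 2 ν) :=
  {a | MemLp (nonlocalGrad a.1) (ENNReal.ofReal p) (ν ⊗ₘ m) ∧
    a.2 =ᵐ[ν] nonlocalDiv m (pFlux p a.1)}

/-- The density `dν₂/dν₁` as a real-valued function. -/
def density {X : Type*} [MeasurableSpace X] (ν₂ ν₁ : Measure X) : X → ℝ :=
  fun x => (ν₂.rnDeriv ν₁ x).toReal

/-- The operator `-Δ_q^{m₁} - μ Δ_p^{m₂}` in `L²(X, ν₁)`, with `μ = dν₂/dν₁`. A pair `(u, v)`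
belongs to it iff `v = -v₁ - μ v₂` for some `(u, v₁) ∈ Δ_q^{m₁}` and `(u, v₂) ∈ Δ_p^{m₂}`. The
second operator lives in `L²(X, ν₂)`, so `u` has to agree `ν₂`-a.e. with an element `u₂` of that
space. -/
def qpOperator {X : Type*} [MeasurableSpace X] (q p : ℝ) (m₁ m₂ : Kernel X X)
    (ν₁ ν₂ : Measure X) : Set (Lp ℝ 2 ν₁ × Lp ℝ 2 ν₁) :=
  {a | ∃ v₁ : Lp ℝ 2 ν₁, (a.1, v₁) ∈ pLaplacian q m₁ ν₁ ∧
    ∃ u₂ v₂ : Lp ℝ 2 ν₂, u₂ =ᵐ[ν₂] a.1 ∧ (u₂, v₂) ∈ pLaplacian p m₂ ν₂ ∧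
      a.2 =ᵐ[ν₁] fun x => -v₁ x - density ν₂ ν₁ x * v₂ x}

end

end RandomWalk

/-!
Write `z_p(u) = |∇u|^(p-2) ∇u` for the flux. It is antisymmetric, so that `Δ_p u(x)` is the average
of `z_p(u)(x, ·)` over the jumps from `x`; by Jensen's inequality `Δ_p u ∈ L^{p'}` as soon as
`∇u ∈ L^p`. Reversibility makes `ν ⊗ m` invariant under the swap of coordinates, which gives the
integration by parts formula `½ ∬ z ∇φ = -∫ (div z) φ` for `z ∈ L^{p'}`, `φ ∈ L^p`
(`integral_mul_nonlocalGrad`). If `div z` and `φ` are in `L²` it is enough that `∇φ ∈ L^p`, because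
the truncations of `φ` are normal contractions of `φ`
(`integral_mul_nonlocalGrad_of_memLp_two`).

The bounds on `μ` say that `ν₁` and `ν₂` are comparable, so that they have the same `L^r` spaces.

* The operator is contained in the subdifferential: by Young's inequality the flux is a subgradient
  of the energy, and the inequality is integrated by parts with `φ = w - u`.
* Conversely, let `v` be a subgradient of the sum at `u`. Testing with `±t 1_s`, `ν₁(s) < ∞`, and
  letting `t → 0` gives `v = -Δ_q u - μ Δ_p u`. It remains to see that both Laplacians are in `L²`.
  Since `q ≤ 2`, `Δ_q u ∈ L^{q'}` with `q' ≥ 2`, which is enough on a finite measure space.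
  Otherwise `p' ≤ 2`, and then the large values of `Δ_q u` are controlled by `L^{q'}` and the small
  ones by `v ∈ L²` and `μ Δ_p u ∈ L^{p'}` (`memLp_two_of_add`).
* Complete accretivity: `∫ g(u₁ - u₂) (v₁ - v₂) ≥ 0` for bounded monotone `g` vanishing near the
  origin, by integration by parts and monotonicity of the flux. For a convex `f` with subgradient
  `g` this implies `∫ f(u₁ - u₂) ≤ ∫ f(u₁ - u₂ + λ (v₁ - v₂))`, and every `j ∈ J₀` is the supremum
  of a countable directed family of such `f` (`JDominated.of_truncatedSubgradient`).
* Density: the integrable simple functions have gradients in every `L^r`, so they belong to the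
  domain.
-/

namespace RandomWalk

/-! ### The power nonlinearity -/

/-- The scalar nonlinearity `s ↦ |s|^(p-2) s`, so that the flux is `fluxFun p ∘ ∇u`. -/
noncomputable def fluxFun (p s : ℝ) : ℝ := |s| ^ (p - 2) * s

lemma fluxFun_neg (p s : ℝ) : fluxFun p (-s) = -fluxFun p s := by
  simp [fluxFun]

lemma fluxFun_mul_self {p : ℝ} (hp : 1 < p) (s : ℝ) : fluxFun p s * s = |s| ^ p := by
  rcases eq_or_ne s 0 with rfl | hs
  · simp [fluxFun, Real.zero_rpow (by linarith : p ≠ 0)]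
  · have h : |s| ^ p = |s| ^ (p - 2) * |s| ^ (2 : ℝ) := by
      rw [← Real.rpow_add (abs_pos.2 hs)]; congr 1; ring
    rw [h, Real.rpow_two, sq_abs, fluxFun]; ring

lemma abs_fluxFun {p : ℝ} (hp : 1 < p) (s : ℝ) : |fluxFun p s| = |s| ^ (p - 1) := by
  rcases eq_or_ne s 0 with rfl | hs
  · simp [fluxFun, Real.zero_rpow (by linarith : p - 1 ≠ 0)]
  · rw [fluxFun, abs_mul, abs_of_nonneg (Real.rpow_nonneg (abs_nonneg s) _),
      ← Real.rpow_add_one (abs_pos.2 hs).ne']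
    congr 1; ring

lemma continuous_fluxFun {p : ℝ} (hp : 1 < p) : Continuous (fluxFun p) := by
  have h : fluxFun p = fun s => (max s 0) ^ (p - 1) - (max (-s) 0) ^ (p - 1) := by
    funext s
    have key : ∀ s : ℝ, 0 ≤ s → fluxFun p s = s ^ (p - 1) := fun s hs => by
      have h0 : 0 ≤ fluxFun p s := mul_nonneg (Real.rpow_nonneg (abs_nonneg s) _) hs
      rw [← abs_of_nonneg h0, abs_fluxFun hp, abs_of_nonneg hs]
    rcases le_total 0 s with hs | hs
    · rw [key s hs, max_eq_left hs, max_eq_right (by linarith),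
        Real.zero_rpow (by linarith : p - 1 ≠ 0), sub_zero]
    · rw [max_eq_right hs, max_eq_left (by linarith), ← key (-s) (by linarith), fluxFun_neg,
        Real.zero_rpow (by linarith : p - 1 ≠ 0)]
      ring
  rw [h]
  have hp' : 0 ≤ p - 1 := by linarith
  exact ((continuous_id.max continuous_const).rpow_const fun _ => Or.inr hp').sub
    ((continuous_neg.max continuous_const).rpow_const fun _ => Or.inr hp')

/-- The subgradient inequality for the convex function `s ↦ |s|^p / p`, an instance of Young's
inequality. -/
lemma fluxFun_mul_sub_le {p : ℝ} (hp : 1 < p) (a b : ℝ) :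
    fluxFun p a * (b - a) ≤ |b| ^ p / p - |a| ^ p / p := by
  have hpq : (p / (p - 1)).HolderConjugate p := (Real.HolderConjugate.conjExponent hp).symm
  have h1 : fluxFun p a * b ≤ |a| ^ (p - 1) * |b| := by
    rw [← abs_fluxFun hp, ← abs_mul]; exact le_abs_self _
  have h2 := Real.young_inequality_of_nonneg (Real.rpow_nonneg (abs_nonneg a) (p - 1))
    (abs_nonneg b) hpq
  rw [← Real.rpow_mul (abs_nonneg a), mul_div_cancel₀ _ (by linarith : p - 1 ≠ 0)] at h2
  have h3 : |a| ^ p / (p / (p - 1)) = |a| ^ p - |a| ^ p / p := by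
    field_simp
  rw [mul_sub, fluxFun_mul_self hp]
  linarith

lemma monotone_fluxFun {p : ℝ} (hp : 1 < p) : Monotone (fluxFun p) := by
  intro a b hab
  rcases hab.eq_or_lt with rfl | hab
  · rfl
  have h1 := fluxFun_mul_sub_le hp a b
  have h2 := fluxFun_mul_sub_le hp b a
  nlinarith

/-- If `g` is monotone then `fluxFun p` and `g` of increments are ordered alike. -/
lemma fluxFun_sub_mul_nonneg {p : ℝ} (hp : 1 < p) {g : ℝ → ℝ} (hg : Monotone g)
    {a b s t : ℝ} (h : a - b = t - s) :
    0 ≤ (fluxFun p a - fluxFun p b) * (g t - g s) := by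
  rcases le_total s t with hst | hst
  · exact mul_nonneg (sub_nonneg.2 (monotone_fluxFun hp (by linarith))) (sub_nonneg.2 (hg hst))
  · exact mul_nonneg_of_nonpos_of_nonpos (sub_nonpos.2 (monotone_fluxFun hp (by linarith)))
      (sub_nonpos.2 (hg hst))

/-! ### Approximating the functions of `J₀` from below -/

/-- `g` is a bounded selection of the subdifferential of `f : ℝ → ℝ`, vanishing near the origin,
and `f 0 = 0`. Such an `f` is a convex Lipschitz function vanishing near the origin. -/
structure IsTruncatedSubgradient (f g : ℝ → ℝ) : Prop where
  map_zero : f 0 = 0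
  subgradient : ∀ x y, f x + g x * (y - x) ≤ f y
  bounded : ∃ C, ∀ x, |g x| ≤ C
  vanishing : ∃ δ > 0, ∀ x, |x| ≤ δ → g x = 0

namespace IsTruncatedSubgradient

variable {f g f₁ g₁ f₂ g₂ : ℝ → ℝ}

lemma monotone (h : IsTruncatedSubgradient f g) : Monotone g := by
  intro x y hxy
  rcases hxy.eq_or_lt with rfl | hxy
  · rfl
  nlinarith [h.subgradient x y, h.subgradient y x]

lemma nonneg (h : IsTruncatedSubgradient f g) (x : ℝ) : 0 ≤ f x := by
  obtain ⟨δ, hδ, h0⟩ := h.vanishing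
  have := h.subgradient 0 x
  rw [h.map_zero, h0 0 (by simpa using hδ.le)] at this
  simpa using this

lemma continuous (h : IsTruncatedSubgradient f g) : Continuous f := by
  obtain ⟨C, hC⟩ := h.bounded
  refine (LipschitzWith.of_le_add_mul (Real.toNNReal C) fun x y => ?_).continuous
  have h1 := h.subgradient x y
  have h2 : g x * (x - y) ≤ C * |x - y| := by
    calc g x * (x - y) ≤ |g x * (x - y)| := le_abs_self _
      _ = |g x| * |x - y| := abs_mul _ _
      _ ≤ C * |x - y| := by gcongr; exact hC x
  rw [Real.coe_toNNReal C ((abs_nonneg _).trans (hC 0)), Real.dist_eq]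
  linarith

lemma le_mul_self (h : IsTruncatedSubgradient f g) (x : ℝ) : f x ≤ g x * x := by
  have := h.subgradient x 0
  rw [h.map_zero] at this
  linarith

lemma zero : IsTruncatedSubgradient 0 0 :=
  ⟨rfl, by simp, ⟨0, by simp⟩, ⟨1, by simp⟩⟩

lemma hinge (a : ℝ) {b : ℝ} (hb : 0 < b) :
    IsTruncatedSubgradient (fun x => max (a * x - b) 0) (fun x => if 0 < a * x - b then a else 0)
    where
  map_zero := by simp [hb.le]
  subgradient x y := by
    split_ifs with h
    · rw [max_eq_left h.le]
      exact le_max_of_le_left (by linarith)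
    · rw [max_eq_right (not_lt.1 h)]
      simp
  bounded := ⟨|a|, fun x => by split_ifs <;> simp⟩
  vanishing := by
    -- The denominator `|a| + 1` instead of `|a|` also covers `a = 0`.
    refine ⟨b / (|a| + 1), by positivity, fun x hx => if_neg (not_lt.2 ?_)⟩
    have h1 : a * x ≤ |a| * |x| := by rw [← abs_mul]; exact le_abs_self _
    have h2 : |x| * (|a| + 1) ≤ b := (le_div_iff₀ (by positivity)).1 hx
    nlinarith [abs_nonneg x]

lemma sup (h₁ : IsTruncatedSubgradient f₁ g₁) (h₂ : IsTruncatedSubgradient f₂ g₂) :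
    IsTruncatedSubgradient (fun x => max (f₁ x) (f₂ x))
      (fun x => if f₂ x ≤ f₁ x then g₁ x else g₂ x) where
  map_zero := by simp [h₁.map_zero, h₂.map_zero]
  subgradient x y := by
    split_ifs with h
    · rw [max_eq_left h]
      exact le_max_of_le_left (h₁.subgradient x y)
    · rw [max_eq_right (not_le.1 h).le]
      exact le_max_of_le_right (h₂.subgradient x y)
  bounded := by
    obtain ⟨C₁, h₁⟩ := h₁.bounded
    obtain ⟨C₂, h₂⟩ := h₂.bounded
    refine ⟨max C₁ C₂, fun x => ?_⟩
    split_ifs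
    · exact (h₁ x).trans (le_max_left _ _)
    · exact (h₂ x).trans (le_max_right _ _)
  vanishing := by
    obtain ⟨δ₁, hδ₁, h₁⟩ := h₁.vanishing
    obtain ⟨δ₂, hδ₂, h₂⟩ := h₂.vanishing
    refine ⟨min δ₁ δ₂, lt_min hδ₁ hδ₂, fun x hx => ?_⟩
    split_ifs
    · exact h₁ x (hx.trans (min_le_left _ _))
    · exact h₂ x (hx.trans (min_le_right _ _))

end IsTruncatedSubgradient

lemma JZero.comp_neg {j : ℝ → ℝ≥0∞} (hj : j ∈ JZero) : (fun s => j (-s)) ∈ JZero := by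
  refine ⟨⟨convex_univ, fun x _ y _ a b ha hb hab => ?_⟩, hj.2.1.comp continuous_neg, ?_⟩
  · have := hj.1.2 (Set.mem_univ (-x)) (Set.mem_univ (-y)) ha hb hab
    rwa [smul_neg, smul_neg, ← neg_add] at this
  · simpa using hj.2.2

/-- Convexity of `j ∈ J₀` between points of finite value: the slopes of chords through a level
`t` below `j s` are ordered. -/
lemma JZero.slope_le {j : ℝ → ℝ≥0∞} (hj : j ∈ JZero) {x s y t : ℝ} (hxs : x < s) (hsy : s < y)
    (hx : j x ≠ ∞) (hy : j y ≠ ∞) (ht : ENNReal.ofReal t ≤ j s) :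
    (t - (j x).toReal) / (s - x) ≤ ((j y).toReal - t) / (y - s) := by
  have hd : 0 < y - x := by linarith
  let a : ℝ≥0 := ⟨(y - s) / (y - x), div_nonneg (by linarith) hd.le⟩
  let b : ℝ≥0 := ⟨(s - x) / (y - x), div_nonneg (by linarith) hd.le⟩
  have hab : a + b = 1 := by
    ext
    change (y - s) / (y - x) + (s - x) / (y - x) = 1
    field_simp
    ring
  have h := hj.1.2 (Set.mem_univ x) (Set.mem_univ y) a.2 b.2 hab
  have hs : a • x + b • y = s := by
    change (y - s) / (y - x) * x + (s - x) / (y - x) * y = s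
    field_simp
    ring
  rw [hs, ENNReal.smul_def, ENNReal.smul_def, smul_eq_mul, smul_eq_mul] at h
  have h' := ENNReal.toReal_mono (by finiteness) (ht.trans h)
  rw [ENNReal.toReal_add (by finiteness) (by finiteness), ENNReal.toReal_mul,
    ENNReal.toReal_mul, ENNReal.coe_toReal, ENNReal.coe_toReal, ENNReal.toReal_ofReal'] at h'
  have h2 : t ≤ (y - s) / (y - x) * (j x).toReal + (s - x) / (y - x) * (j y).toReal :=
    (le_max_left _ _).trans h'
  rw [div_mul_eq_mul_div, div_mul_eq_mul_div, ← add_div, le_div_iff₀ hd] at h2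
  rw [div_le_div_iff₀ (by linarith) (by linarith)]
  nlinarith

/-- A support line below `j ∈ J₀` reaching a prescribed level below `j s`. Lower semicontinuity
bounds the slopes on the left of `s`, also when `j = ∞` on the right of `s`. -/
lemma JZero.exists_affine_le {j : ℝ → ℝ≥0∞} (hj : j ∈ JZero) {s t : ℝ} (hs : 0 < s)
    (ht : 0 < t) (hts : ENNReal.ofReal t < j s) :
    ∃ a b : ℝ, 0 ≤ a ∧ 0 ≤ b ∧ a * s - b = t ∧ ∀ y, ENNReal.ofReal (a * y - b) ≤ j y := by
  obtain ⟨δ, hδ, hball⟩ := Metric.eventually_nhds_iff.1 (hj.2.1 s _ hts)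
  set S : Set ℝ := {r | ∃ x < s, j x ≠ ∞ ∧ r = (t - (j x).toReal) / (s - x)}
  have hbdd : BddAbove S := by
    refine ⟨t / δ, ?_⟩
    rintro _ ⟨x, hx, hjx, rfl⟩
    have hsx : 0 < s - x := by linarith
    -- Close to `s` the value of `j` exceeds `t` and the slope is negative; further away the
    -- denominator is at least `δ`.
    by_cases hxδ : s - x < δ
    · have h1 := hball (y := x) (by rw [dist_comm, Real.dist_eq, abs_of_pos hsx]; exact hxδ)
      have h2 := (ENNReal.ofReal_lt_iff_lt_toReal ht.le hjx).1 h1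
      exact (div_nonpos_of_nonpos_of_nonneg (by linarith) hsx.le).trans (by positivity)
    · have : 0 ≤ (j x).toReal := ENNReal.toReal_nonneg
      exact div_le_div₀ ht.le (by linarith) hδ (not_lt.1 hxδ)
  have h0 : t / s ∈ S := ⟨0, hs, by simp [hj.2.2], by simp [hj.2.2]⟩
  have ha := le_csSup hbdd h0
  rw [div_le_iff₀ hs] at ha
  refine ⟨sSup S, sSup S * s - t, (div_nonneg ht.le hs.le).trans (le_csSup hbdd h0), by linarith,
    by ring, fun y => ?_⟩
  by_cases hjy : j y = ∞
  · simp [hjy]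
  refine ENNReal.ofReal_le_of_le_toReal ?_
  rcases lt_trichotomy y s with hys | rfl | hys
  · have := le_csSup hbdd ⟨y, hys, hjy, rfl⟩
    rw [div_le_iff₀ (by linarith)] at this
    linarith
  · have := (ENNReal.ofReal_lt_iff_lt_toReal ht.le hjy).1 hts
    linarith
  · have : sSup S ≤ ((j y).toReal - t) / (y - s) := by
      refine csSup_le ⟨_, h0⟩ ?_
      rintro _ ⟨x, hx, hjx, rfl⟩
      exact JZero.slope_le hj hx hys hjx hjy hts.le
    rw [le_div_iff₀ (by linarith)] at this
    linarith

lemma JZero.exists_rat_affine_le_of_pos {j : ℝ → ℝ≥0∞} (hj : j ∈ JZero) {s : ℝ} (hs : 0 < s)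
    {c : ℝ≥0∞} (hc : c < j s) :
    ∃ a b : ℚ, 0 < b ∧ (∀ y : ℝ, ENNReal.ofReal (a * y - b) ≤ j y) ∧
      c ≤ ENNReal.ofReal (a * s - b) := by
  obtain ⟨t, hct, htj⟩ := ENNReal.lt_iff_exists_nnreal_btwn.1 hc
  have ht : (0 : ℝ) < t := NNReal.coe_pos.2 (ENNReal.coe_pos.1 (bot_le.trans_lt hct))
  have hcr : c.toReal < t := by
    simpa using ENNReal.toReal_strict_mono ENNReal.coe_ne_top hct
  obtain ⟨a, b, ha, hb, hab, hle⟩ := JZero.exists_affine_le hj hs ht (by simpa using htj)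
  have ha' : 0 < a := by
    by_contra! h
    nlinarith
  -- Lowering the slope and the intercept slightly keeps the line below `j`: it only matters for
  -- positive arguments.
  set ε := (t - c.toReal) / 2
  have hε : 0 < ε := by simp only [ε]; linarith
  obtain ⟨a', ha1, ha2⟩ := exists_rat_btwn (show max 0 (a - ε / s) < a from
    max_lt ha' (by linarith [div_pos hε hs]))
  obtain ⟨b', hb1, hb2⟩ := exists_rat_btwn (show b < b + ε by linarith)
  have ha0 : (0 : ℝ) < a' := (le_max_left _ _).trans_lt ha1
  refine ⟨a', b', by exact_mod_cast hb.trans_lt hb1, fun y => ?_, ?_⟩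
  · rcases le_total 0 y with hy | hy
    · refine (ENNReal.ofReal_le_ofReal ?_).trans (hle y)
      nlinarith
    · rw [ENNReal.ofReal_of_nonpos (by nlinarith)]
      exact bot_le
  · rw [ENNReal.le_ofReal_iff_toReal_le hct.ne_top]
    · have h1 : a - ε / s < a' := (le_max_right _ _).trans_lt ha1
      have h2 : (a - ε / s) * s ≤ a' * s := by gcongr
      rw [sub_mul, div_mul_cancel₀ _ hs.ne'] at h2
      have : ε + ε = t - c.toReal := by simp only [ε]; ring
      linarith
    · have h1 : a - ε / s < a' := (le_max_right _ _).trans_lt ha1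
      have h2 : (a - ε / s) * s ≤ a' * s := by gcongr
      rw [sub_mul, div_mul_cancel₀ _ hs.ne'] at h2
      have : ε + ε = t - c.toReal := by simp only [ε]; ring
      have := ENNReal.toReal_nonneg (a := c)
      linarith

lemma JZero.exists_rat_affine_le {j : ℝ → ℝ≥0∞} (hj : j ∈ JZero) (s : ℝ)
    {c : ℝ≥0∞} (hc : c < j s) :
    ∃ a b : ℚ, 0 < b ∧ (∀ y : ℝ, ENNReal.ofReal (a * y - b) ≤ j y) ∧
      c ≤ ENNReal.ofReal (a * s - b) := by
  rcases lt_trichotomy s 0 with hs | rfl | hs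
  · obtain ⟨a, b, hb, hle, hcs⟩ := JZero.exists_rat_affine_le_of_pos (JZero.comp_neg hj)
      (neg_pos.2 hs) (by simpa using hc)
    refine ⟨-a, b, hb, fun y => ?_, ?_⟩
    · simpa using hle (-y)
    · simpa using hcs
  · simp [hj.2.2] at hc
  · exact JZero.exists_rat_affine_le_of_pos hj hs hc

/-- To prove `u ≪ v` it is enough to test with convex functions that have a bounded subgradient
vanishing near the origin: every `j ∈ J₀` is the supremum of countably many hinge functions. -/
lemma JDominated.of_truncatedSubgradient {X : Type*} [MeasurableSpace X] {ν : Measure X}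
    {u v : X → ℝ} (hu : AEMeasurable u ν)
    (h : ∀ f g : ℝ → ℝ, IsTruncatedSubgradient f g →
      ∫⁻ x, ENNReal.ofReal (f (u x)) ∂ν ≤ ∫⁻ x, ENNReal.ofReal (f (v x)) ∂ν) :
    JDominated ν u v := by
  intro j hj
  let Q := {i : ℚ × ℚ // 0 < i.2 ∧ ∀ y : ℝ, ENNReal.ofReal (i.1 * y - i.2) ≤ j y}
  let J : Finset Q → ℝ → ℝ≥0∞ := fun F y => F.sup fun i => ENNReal.ofReal (i.1.1 * y - i.1.2)
  have hJle : ∀ F y, J F y ≤ j y := fun F y => Finset.sup_le fun i _ => i.2.2 y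
  have hJmono : Monotone J := fun F G hFG y => Finset.sup_mono hFG
  have hJ : ∀ F, ∃ f g, IsTruncatedSubgradient f g ∧ ∀ y, J F y = ENNReal.ofReal (f y) := by
    classical
    intro F
    induction F using Finset.induction_on with
    | empty => exact ⟨0, 0, .zero, fun y => by simp [J]⟩
    | insert i F _ ih =>
      obtain ⟨f, g, hfg, hF⟩ := ih
      refine ⟨_, _, (IsTruncatedSubgradient.hinge (i.1.1 : ℝ)
        (b := (i.1.2 : ℝ)) (by exact_mod_cast i.2.1)).sup hfg, fun y => ?_⟩
      have : J (insert i F) y = ENNReal.ofReal (i.1.1 * y - i.1.2) ⊔ J F y := Finset.sup_insert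
      rw [this, hF, ENNReal.ofReal_max, ENNReal.ofReal_max]
      simp
  have hsup : ∀ y, j y = ⨆ F, J F y := by
    intro y
    refine le_antisymm (le_of_forall_lt fun c hc => ?_) (iSup_le fun F => hJle F y)
    obtain ⟨d, hcd, hd⟩ := exists_between hc
    obtain ⟨a, b, hb, hle, hds⟩ := JZero.exists_rat_affine_le hj y hd
    refine hcd.trans_le (hds.trans ?_)
    refine le_iSup_of_le {(⟨(a, b), hb, hle⟩ : Q)} ?_
    simp [J]
  calc ∫⁻ x, j (u x) ∂ν = ∫⁻ x, ⨆ F, J F (u x) ∂ν := by simp_rw [hsup]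
    _ = ⨆ F, ∫⁻ x, J F (u x) ∂ν := by
      refine lintegral_iSup_directed (fun F => ?_)
        (directed_of_isDirected_le fun F G hFG x => hJmono hFG (u x))
      obtain ⟨f, g, hfg, hF⟩ := hJ F
      simp_rw [hF]
      exact (hfg.continuous.measurable.comp_aemeasurable hu).ennreal_ofReal
    _ ≤ ∫⁻ x, j (v x) ∂ν := by
      refine iSup_le fun F => ?_
      obtain ⟨f, g, hfg, hF⟩ := hJ F
      calc ∫⁻ x, J F (u x) ∂ν = ∫⁻ x, ENNReal.ofReal (f (u x)) ∂ν := by simp_rw [hF]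
        _ ≤ ∫⁻ x, ENNReal.ofReal (f (v x)) ∂ν := h f g hfg
        _ = ∫⁻ x, J F (v x) ∂ν := by simp_rw [hF]
        _ ≤ ∫⁻ x, j (v x) ∂ν := lintegral_mono fun x => hJle F (v x)

variable {X : Type*} [MeasurableSpace X]

/-! ### Integration on a reversible random walk space -/

section Reversible

/-- On antisymmetric fields the divergence is the average over the jumps. -/
lemma nonlocalDiv_of_antisymm {m : Kernel X X} {z : X × X → ℝ} (hz : ∀ a, z a.swap = -z a)
    (x : X) :
    nonlocalDiv m z x = ∫ y, z (x, y) ∂(m x) := by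
  have : ∀ y, z (x, y) - z (y, x) = 2 * z (x, y) := fun y => by
    rw [show z (y, x) = -z (x, y) from hz (x, y)]; ring
  simp_rw [nonlocalDiv, this, integral_const_mul]
  ring

variable {m : Kernel X X} [IsMarkovKernel m] {ν : Measure X} [SigmaFinite ν]

/-- Reversibility, assumed on rectangles, extends to the product σ-algebra because the rectangles
over a σ-finite exhaustion of `X` generate it. -/
lemma measurePreserving_swap (hrev : m.IsReversible ν) :
    MeasurePreserving Prod.swap (ν ⊗ₘ m) (ν ⊗ₘ m) := by
  refine ⟨measurable_swap, ?_⟩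
  have hrect : ∀ s t : Set X, MeasurableSet s → MeasurableSet t →
      ((ν ⊗ₘ m).map Prod.swap) (s ×ˢ t) = (ν ⊗ₘ m) (s ×ˢ t) := by
    intro s t hs ht
    rw [Measure.map_apply measurable_swap (hs.prod ht), Set.preimage_swap_prod,
      Measure.compProd_apply_prod ht hs, Measure.compProd_apply_prod hs ht, hrev ht hs]
  refine Measure.ext_of_generateFrom_of_iUnion _ (fun n => spanningSets ν n ×ˢ Set.univ)
    generateFrom_prod.symm isPiSystem_prod ?_ ?_ ?_ ?_
  · rw [← Set.iUnion_prod_const, iUnion_spanningSets, Set.univ_prod_univ]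
  · exact fun n => ⟨_, measurableSet_spanningSets ν n, _, MeasurableSet.univ, rfl⟩
  · intro n
    rw [hrect _ _ (measurableSet_spanningSets ν n) MeasurableSet.univ,
      Measure.compProd_apply_prod (measurableSet_spanningSets ν n) MeasurableSet.univ]
    simpa using (measure_spanningSets_lt_top ν n).ne
  · rintro _ ⟨s, hs, t, ht, rfl⟩
    exact hrect s t hs ht

lemma measurePreserving_fst : MeasurePreserving Prod.fst (ν ⊗ₘ m) ν :=
  ⟨measurable_fst, Measure.fst_compProd ν m⟩

lemma measurePreserving_snd (hrev : m.IsReversible ν) :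
    MeasurePreserving Prod.snd (ν ⊗ₘ m) ν :=
  measurePreserving_fst.comp (measurePreserving_swap hrev)

lemma memLp_nonlocalGrad (hrev : m.IsReversible ν) {u : X → ℝ} {r : ℝ≥0∞} (hu : MemLp u r ν) :
    MemLp (nonlocalGrad u) r (ν ⊗ₘ m) :=
  (hu.comp_measurePreserving (measurePreserving_snd hrev)).sub
    (hu.comp_measurePreserving measurePreserving_fst)

lemma nonlocalGrad_ae_eq (hrev : m.IsReversible ν) {u w : X → ℝ} (h : u =ᵐ[ν] w) :
    nonlocalGrad u =ᵐ[ν ⊗ₘ m] nonlocalGrad w :=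
  ((measurePreserving_snd hrev).quasiMeasurePreserving.ae_eq_comp h).sub
    ((measurePreserving_fst (m := m)).quasiMeasurePreserving.ae_eq_comp h)

/-- Jensen's inequality: the divergence of an antisymmetric field in `L^r` is in `L^r`. -/
lemma memLp_nonlocalDiv {z : X × X → ℝ} (hzm : StronglyMeasurable z)
    (hz : ∀ a, z a.swap = -z a) {r : ℝ} (hr : 1 ≤ r)
    (hzr : MemLp z (ENNReal.ofReal r) (ν ⊗ₘ m)) :
    MemLp (nonlocalDiv m z) (ENNReal.ofReal r) ν := by
  have hr0 : 0 < r := by linarith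
  have h0 : ENNReal.ofReal r ≠ 0 := by simpa using hr0
  have hmeas : StronglyMeasurable (nonlocalDiv m z) := by
    rw [funext (nonlocalDiv_of_antisymm (m := m) hz)]
    exact hzm.integral_kernel_prod_right'
  refine ⟨hmeas.aestronglyMeasurable, ?_⟩
  rw [eLpNorm_lt_top_iff_lintegral_rpow_enorm_lt_top h0 ENNReal.ofReal_ne_top,
    ENNReal.toReal_ofReal hr0.le]
  have hfin := (eLpNorm_lt_top_iff_lintegral_rpow_enorm_lt_top h0 ENNReal.ofReal_ne_top).1 hzr.2
  rw [ENNReal.toReal_ofReal hr0.le, Measure.lintegral_compProd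
    (hzm.measurable.enorm.pow_const r)] at hfin
  refine (lintegral_mono fun x => ?_).trans_lt hfin
  have hzx : StronglyMeasurable fun y => z (x, y) :=
    hzm.comp_measurable measurable_prodMk_left
  rw [nonlocalDiv_of_antisymm hz]
  calc ‖∫ y, z (x, y) ∂(m x)‖ₑ ^ r ≤ (eLpNorm (fun y => z (x, y)) 1 (m x)) ^ r := by
        gcongr
        rw [eLpNorm_one_eq_lintegral_enorm]
        exact enorm_integral_le_lintegral_enorm _
    _ ≤ (eLpNorm (fun y => z (x, y)) (ENNReal.ofReal r) (m x)) ^ r := by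
        gcongr
        exact eLpNorm_le_eLpNorm_of_exponent_le (by simpa using hr) hzx.aestronglyMeasurable
    _ = ∫⁻ y, ‖z (x, y)‖ₑ ^ r ∂(m x) := by
        rw [eLpNorm_eq_lintegral_rpow_enorm_toReal h0 ENNReal.ofReal_ne_top,
          ENNReal.toReal_ofReal hr0.le, ← ENNReal.rpow_mul, one_div, inv_mul_cancel₀ hr0.ne',
          ENNReal.rpow_one]

/-- Integration by parts against a test function in `L^s`, for a field in `L^r` with `r`, `s`
conjugate. Reversibility turns `∬ z(x, y) φ(y)` into `-∬ z(x, y) φ(x)`. -/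
lemma integral_mul_nonlocalGrad (hrev : m.IsReversible ν) {z : X × X → ℝ}
    (hz : ∀ a, z a.swap = -z a) {r s : ℝ≥0∞} [r.HolderConjugate s]
    (hzr : MemLp z r (ν ⊗ₘ m)) {φ : X → ℝ} (hφ : MemLp φ s ν) :
    (1 / 2 : ℝ) * ∫ a, z a * nonlocalGrad φ a ∂(ν ⊗ₘ m) = -∫ x, nonlocalDiv m z x * φ x ∂ν := by
  have hfst : Integrable (fun a => z a * φ a.1) (ν ⊗ₘ m) :=
    hzr.integrable_mul (hφ.comp_measurePreserving measurePreserving_fst)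
  have hsnd : Integrable (fun a => z a * φ a.2) (ν ⊗ₘ m) :=
    hzr.integrable_mul (hφ.comp_measurePreserving (measurePreserving_snd hrev))
  have hswap : ∫ a, z a * φ a.2 ∂(ν ⊗ₘ m) = -∫ a, z a * φ a.1 ∂(ν ⊗ₘ m) := by
    rw [← (measurePreserving_swap hrev).integral_comp
      MeasurableEquiv.prodComm.measurableEmbedding, ← integral_neg]
    simp [hz]
  have hdiv : ∫ a, z a * φ a.1 ∂(ν ⊗ₘ m) = ∫ x, nonlocalDiv m z x * φ x ∂ν := by
    rw [Measure.integral_compProd hfst]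
    simp_rw [integral_mul_const, nonlocalDiv_of_antisymm hz]
  have hgrad : ∀ a, z a * nonlocalGrad φ a = z a * φ a.2 - z a * φ a.1 :=
    fun a => mul_sub _ _ _
  simp_rw [hgrad]
  rw [integral_sub hsnd hfst, hswap, hdiv]
  ring

/-! ### Truncation, and integration by parts against square integrable functions -/

/-- A bounded function vanishing near the origin sends `L²` to every `L^r`. -/
lemma memLp_comp_of_vanishing {α : Type*} [MeasurableSpace α] {ν : Measure α} {u : α → ℝ}
    (hu : MemLp u 2 ν) {h : ℝ → ℝ} (hh : Measurable h)
    {C : ℝ} (hC : ∀ s, |h s| ≤ C) {δ : ℝ} (hδ : 0 < δ) (h0 : ∀ s, |s| ≤ δ → h s = 0)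
    (r : ℝ≥0∞) : MemLp (fun x => h (u x)) r ν := by
  obtain ⟨w, hw, huw⟩ := hu.1
  have hw2 : MemLp w 2 ν := hu.ae_eq huw
  have hfin : ν {x | δ ≤ ‖w x‖} < ∞ := by
    have := hw2.meas_ge_lt_top (ε := ⟨δ, hδ.le⟩) two_ne_zero ENNReal.ofNat_ne_top
      (fun h => hδ.ne' (congrArg NNReal.toReal h))
    exact this
  have hmeas : MeasurableSet {x | δ ≤ ‖w x‖} :=
    measurableSet_le measurable_const hw.measurable.norm
  have hb : MemLp ({x | δ ≤ ‖w x‖}.indicator fun _ => C) r ν :=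
    memLp_indicator_const r hmeas C (Or.inr hfin.ne)
  have hhw : MemLp (fun x => h (w x)) r ν := by
    refine hb.mono (hh.comp hw.measurable).aestronglyMeasurable (ae_of_all _ fun x => ?_)
    by_cases hx : δ ≤ ‖w x‖
    · rw [Set.indicator_of_mem (show x ∈ {x | δ ≤ ‖w x‖} from hx)]
      exact (hC _).trans (le_abs_self C)
    · rw [h0 _ (not_le.1 hx).le, norm_zero]
      exact norm_nonneg _
  exact hhw.ae_eq (huw.mono fun x hx => by simp only [hx])

/-- Truncation at height `n` from above and at height `1/(n+1)` from below: a contraction of the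
line that is bounded and vanishes near the origin, converging to the identity. -/
noncomputable def truncation (n : ℕ) (s : ℝ) : ℝ :=
  max (min (s - 1 / (n + 1)) n) 0 - max (min (-s - 1 / (n + 1)) n) 0

lemma continuous_truncation (n : ℕ) : Continuous (truncation n) := by
  unfold truncation
  fun_prop

lemma abs_truncation_le (n : ℕ) (s : ℝ) : |truncation n s| ≤ n := by
  have h (t : ℝ) : 0 ≤ max (min t (n : ℝ)) 0 ∧ max (min t (n : ℝ)) 0 ≤ n :=
    ⟨le_max_right _ _, max_le (min_le_right _ _) n.cast_nonneg⟩
  have h1 := h (s - 1 / (n + 1))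
  have h2 := h (-s - 1 / (n + 1))
  rw [truncation, abs_le]
  constructor <;> linarith

lemma truncation_of_abs_le {n : ℕ} {s : ℝ} (hs : |s| ≤ 1 / (n + 1)) : truncation n s = 0 := by
  rw [abs_le] at hs
  rw [truncation, max_eq_right ((min_le_left _ _).trans (by linarith)),
    max_eq_right ((min_le_left _ _).trans (by linarith)), sub_zero]

lemma abs_truncation_sub_le (n : ℕ) (s t : ℝ) :
    |truncation n s - truncation n t| ≤ |s - t| := by
  wlog hst : s ≤ t generalizing s t
  · rw [abs_sub_comm, abs_sub_comm s]
    exact this t s (not_le.1 hst).le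
  have hε : (0 : ℝ) < 1 / (n + 1) := by positivity
  have hn : (0 : ℝ) ≤ n := n.cast_nonneg
  have hmono (a b : ℝ) (hab : a ≤ b) : max (min a (n : ℝ)) 0 ≤ max (min b (n : ℝ)) 0 ∧
      max (min b (n : ℝ)) 0 - max (min a (n : ℝ)) 0 ≤ b - a := by
    refine ⟨by gcongr, ?_⟩
    rcases le_total a n with h1 | h1 <;> rcases le_total b n with h2 | h2 <;>
      rcases le_total a 0 with h3 | h3 <;> rcases le_total b 0 with h4 | h4 <;>
      simp only [min_eq_left, min_eq_right, max_eq_left, max_eq_right, h1, h2, h3, h4, hn] <;>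
      linarith
  have hzero (a : ℝ) (ha : a ≤ 0) : max (min (a - 1 / (n + 1)) (n : ℝ)) 0 = 0 :=
    max_eq_right ((min_le_left _ _).trans (by linarith))
  have hpos (a : ℝ) (ha : 0 ≤ a) : 0 ≤ max (min (a - 1 / (n + 1)) (n : ℝ)) 0 ∧
      max (min (a - 1 / (n + 1)) (n : ℝ)) 0 ≤ a :=
    ⟨le_max_right _ _, max_le ((min_le_left _ _).trans (by linarith)) ha⟩
  have h1 := hmono (s - 1 / (n + 1)) (t - 1 / (n + 1)) (by linarith)
  have h2 := hmono (-t - 1 / (n + 1)) (-s - 1 / (n + 1)) (by linarith)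
  rw [abs_sub_comm, abs_sub_comm s, abs_of_nonneg (by linarith : 0 ≤ t - s), truncation,
    truncation, abs_le]
  rcases le_total 0 s with hs | hs
  · rw [hzero (-s) (by linarith), hzero (-t) (by linarith)]
    constructor <;> linarith
  · rcases le_total 0 t with ht | ht
    · rw [hzero s hs, hzero (-t) (by linarith)]
      have := hpos t ht
      have := hpos (-s) (by linarith)
      constructor <;> linarith
    · rw [hzero s hs, hzero t ht]
      constructor <;> linarith

lemma abs_truncation_le_abs (n : ℕ) (s : ℝ) : |truncation n s| ≤ |s| := by
  have h0 : truncation n 0 = 0 := truncation_of_abs_le (by rw [abs_zero]; positivity)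
  simpa [h0] using abs_truncation_sub_le n s 0

lemma tendsto_truncation (s : ℝ) :
    Filter.Tendsto (fun n => truncation n s) Filter.atTop (nhds s) := by
  refine tendsto_iff_dist_tendsto_zero.2 (squeeze_zero' (Filter.Eventually.of_forall fun _ =>
    dist_nonneg) ?_ tendsto_one_div_add_atTop_nhds_zero_nat)
  obtain ⟨N, hN⟩ := exists_nat_ge |s|
  filter_upwards [Filter.eventually_ge_atTop N] with n hn
  have hε : (0 : ℝ) < 1 / (n + 1) := by positivity
  have hs := abs_le.1 (hN.trans (Nat.cast_le.2 hn))
  rw [Real.dist_eq, truncation, min_eq_left (by linarith), min_eq_left (by linarith), abs_le]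
  rcases le_total (s - 1 / (n + 1)) 0 with h1 | h1 <;>
    rcases le_total (-s - 1 / (n + 1)) 0 with h2 | h2 <;>
    simp only [max_eq_left, max_eq_right, h1, h2] <;> constructor <;> linarith

lemma memLp_truncation {α : Type*} [MeasurableSpace α] {ν : Measure α} {u : α → ℝ}
    (hu : MemLp u 2 ν) (n : ℕ) (r : ℝ≥0∞) :
    MemLp (fun x => truncation n (u x)) r ν :=
  memLp_comp_of_vanishing hu (continuous_truncation n).measurable (abs_truncation_le n)
    (by positivity) (fun _ => truncation_of_abs_le) r

/-- Integration by parts against a test function in `L²` whose gradient lies in `L^s`, when the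
divergence is square integrable. The truncations of the test function are admissible in
`integral_mul_nonlocalGrad`, and their gradients are dominated by the original gradient. -/
lemma integral_mul_nonlocalGrad_of_memLp_two (hrev : m.IsReversible ν) {z : X × X → ℝ}
    (hz : ∀ a, z a.swap = -z a) {r s : ℝ≥0∞} [r.HolderConjugate s]
    (hzr : MemLp z r (ν ⊗ₘ m)) (hdiv : MemLp (nonlocalDiv m z) 2 ν)
    {φ : X → ℝ} (hφ : MemLp φ 2 ν) (hφs : MemLp (nonlocalGrad φ) s (ν ⊗ₘ m)) :
    (1 / 2 : ℝ) * ∫ a, z a * nonlocalGrad φ a ∂(ν ⊗ₘ m) = -∫ x, nonlocalDiv m z x * φ x ∂ν := by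
  let φn (n : ℕ) (x : X) : ℝ := truncation n (φ x)
  have hφn (n : ℕ) (t : ℝ≥0∞) : MemLp (φn n) t ν := memLp_truncation hφ n t
  have hlim1 : Filter.Tendsto (fun n => ∫ a, z a * nonlocalGrad (φn n) a ∂(ν ⊗ₘ m)) Filter.atTop
      (nhds (∫ a, z a * nonlocalGrad φ a ∂(ν ⊗ₘ m))) := by
    refine tendsto_integral_of_dominated_convergence (fun a => ‖z a * nonlocalGrad φ a‖)
      (fun n => ?_) (hzr.integrable_mul hφs).norm (fun n => ae_of_all _ fun a => ?_)
      (ae_of_all _ fun a => ?_)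
    · exact hzr.1.mul (memLp_nonlocalGrad hrev (hφn n s)).1
    · rw [norm_mul, norm_mul]
      gcongr
      exact abs_truncation_sub_le n _ _
    · exact ((tendsto_truncation _).sub (tendsto_truncation _)).const_mul _
  have hlim2 : Filter.Tendsto (fun n => ∫ x, nonlocalDiv m z x * φn n x ∂ν) Filter.atTop
      (nhds (∫ x, nonlocalDiv m z x * φ x ∂ν)) := by
    refine tendsto_integral_of_dominated_convergence (fun x => ‖nonlocalDiv m z x * φ x‖)
      (fun n => ?_) (hdiv.integrable_mul hφ).norm (fun n => ae_of_all _ fun x => ?_)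
      (ae_of_all _ fun x => ?_)
    · exact hdiv.1.mul (hφn n 2).1
    · rw [norm_mul, norm_mul]
      gcongr
      exact abs_truncation_le_abs n _
    · exact (tendsto_truncation _).const_mul _
  refine tendsto_nhds_unique (hlim1.const_mul (1 / 2 : ℝ)) ?_
  simp_rw [fun n => integral_mul_nonlocalGrad hrev hz hzr (hφn n s)]
  exact hlim2.neg

end Reversible

/-! ### The flux and the energy -/

lemma pFlux_eq {X : Type*} (p : ℝ) (u : X → ℝ) (a : X × X) :
    pFlux p u a = fluxFun p (nonlocalGrad u a) := rfl

lemma pFlux_swap {X : Type*} (p : ℝ) (u : X → ℝ) (a : X × X) : pFlux p u a.swap = -pFlux p u a := by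
  rw [pFlux_eq, pFlux_eq, ← fluxFun_neg]
  congr 1
  simp [nonlocalGrad]

lemma stronglyMeasurable_nonlocalGrad {u : X → ℝ} (hu : StronglyMeasurable u) :
    StronglyMeasurable (nonlocalGrad u) :=
  (hu.comp_measurable measurable_snd).sub (hu.comp_measurable measurable_fst)

lemma stronglyMeasurable_pFlux {p : ℝ} (hp : 1 < p) {u : X → ℝ} (hu : StronglyMeasurable u) :
    StronglyMeasurable (pFlux p u) :=
  (continuous_fluxFun hp).comp_stronglyMeasurable (stronglyMeasurable_nonlocalGrad hu)

lemma memLp_fluxFun_comp {α : Type*} [MeasurableSpace α] {ν : Measure α} {p r : ℝ} (hp : 1 < p)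
    {f : α → ℝ} (hf : MemLp f (ENNReal.ofReal (r * (p - 1))) ν) :
    MemLp (fun x => fluxFun p (f x)) (ENNReal.ofReal r) ν := by
  have hp' : 0 < p - 1 := by linarith
  have h := hf.norm_rpow_div (ENNReal.ofReal (p - 1))
  rw [ENNReal.toReal_ofReal hp'.le, ← ENNReal.ofReal_div_of_pos hp',
    mul_div_cancel_right₀ _ hp'.ne'] at h
  refine (memLp_congr_norm ?_ h.1 (ae_of_all _ fun x => ?_)).2 h
  · exact (continuous_fluxFun hp).comp_aestronglyMeasurable hf.1
  · rw [Real.norm_eq_abs, Real.norm_eq_abs, abs_fluxFun hp, Real.norm_eq_abs,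
      abs_of_nonneg (Real.rpow_nonneg (abs_nonneg _) _)]

lemma holderConjugate_ofReal {p : ℝ} (hp : 1 < p) :
    (ENNReal.ofReal (p / (p - 1))).HolderConjugate (ENNReal.ofReal p) :=
  (Real.HolderConjugate.conjExponent hp).symm.ennrealOfReal

lemma memLp_fluxFun_comp_conj {α : Type*} [MeasurableSpace α] {ν : Measure α} {p : ℝ}
    (hp : 1 < p) {f : α → ℝ} (hf : MemLp f (ENNReal.ofReal p) ν) :
    MemLp (fun x => fluxFun p (f x)) (ENNReal.ofReal (p / (p - 1))) ν :=
  memLp_fluxFun_comp hp (by rwa [div_mul_cancel₀ _ (by linarith : p - 1 ≠ 0)])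

section Energy

variable {m : Kernel X X} {ν : Measure X}

/-- The real-valued energy `1/(2p) ∬ |∇u|^p`, meaningful when `∇u` is in `L^p`. -/
noncomputable def realEnergy (p : ℝ) (m : Kernel X X) (ν : Measure X) (u : X → ℝ) : ℝ :=
  1 / (2 * p) * ∫ a, |nonlocalGrad u a| ^ p ∂(ν ⊗ₘ m)

lemma integrable_abs_rpow {α : Type*} [MeasurableSpace α] {ν : Measure α} {p : ℝ} (hp : 0 < p)
    {f : α → ℝ} (hf : MemLp f (ENNReal.ofReal p) ν) : Integrable (fun x => |f x| ^ p) ν := by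
  have := hf.integrable_norm_rpow (by simpa using hp) ENNReal.ofReal_ne_top
  simpa [ENNReal.toReal_ofReal hp.le] using this

lemma pEnergy_eq {p : ℝ} (hp : 1 < p) {u : X → ℝ}
    (h : MemLp (nonlocalGrad u) (ENNReal.ofReal p) (ν ⊗ₘ m)) :
    pEnergy p m ν u = realEnergy p m ν u := by
  rw [pEnergy, realEnergy, ← ofReal_integral_eq_lintegral_ofReal
    (integrable_abs_rpow (by linarith) h)
    (ae_of_all _ fun _ => Real.rpow_nonneg (abs_nonneg _) _),
    ← ENNReal.ofReal_mul (by positivity), EReal.coe_ennreal_ofReal, max_eq_left]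
  exact mul_nonneg (by positivity)
    (integral_nonneg fun _ => Real.rpow_nonneg (abs_nonneg _) _)

lemma pEnergy_nonneg (p : ℝ) (m : Kernel X X) (ν : Measure X) (u : X → ℝ) :
    0 ≤ pEnergy p m ν u :=
  EReal.coe_ennreal_nonneg _

lemma memLp_nonlocalGrad_of_pEnergy {p : ℝ} (hp : 1 < p) {u : X → ℝ} (hu : StronglyMeasurable u)
    (h : pEnergy p m ν u ≠ ⊤) : MemLp (nonlocalGrad u) (ENNReal.ofReal p) (ν ⊗ₘ m) := by
  have hp0 : 0 < p := by linarith
  refine ⟨(stronglyMeasurable_nonlocalGrad hu).aestronglyMeasurable, ?_⟩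
  rw [eLpNorm_lt_top_iff_lintegral_rpow_enorm_lt_top (by simpa using hp0) ENNReal.ofReal_ne_top,
    ENNReal.toReal_ofReal hp0.le]
  have h1 : ENNReal.ofReal (1 / (2 * p)) ≠ 0 := by
    simpa using hp0
  have h2 : ENNReal.ofReal (1 / (2 * p)) *
      ∫⁻ a, ENNReal.ofReal (|nonlocalGrad u a| ^ p) ∂(ν ⊗ₘ m) ≠ ∞ := fun h' =>
    h (by rw [pEnergy, h']; rfl)
  have h3 := ENNReal.lt_top_of_mul_ne_top_right h2 h1
  refine (lintegral_congr fun a => ?_).trans_lt h3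
  rw [Real.enorm_eq_ofReal_abs, ENNReal.ofReal_rpow_of_nonneg (abs_nonneg _) hp0.le]

/-- The flux of `u` is a subgradient of the energy at `u`. -/
lemma integral_pFlux_mul_le {p : ℝ} (hp : 1 < p) {u w : X → ℝ}
    (hu : MemLp (nonlocalGrad u) (ENNReal.ofReal p) (ν ⊗ₘ m))
    (hw : MemLp (nonlocalGrad w) (ENNReal.ofReal p) (ν ⊗ₘ m)) :
    (1 / 2 : ℝ) * ∫ a, pFlux p u a * nonlocalGrad (w - u) a ∂(ν ⊗ₘ m) ≤
      realEnergy p m ν w - realEnergy p m ν u := by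
  have := holderConjugate_ofReal hp
  have hp0 : 0 < p := by linarith
  have hgrad (a : X × X) : nonlocalGrad (w - u) a = nonlocalGrad w a - nonlocalGrad u a := by
    simp only [nonlocalGrad, Pi.sub_apply]; ring
  have hiu := (integrable_abs_rpow hp0 hu).div_const p
  have hiw := (integrable_abs_rpow hp0 hw).div_const p
  have hi : Integrable (fun a => pFlux p u a * (nonlocalGrad w a - nonlocalGrad u a)) (ν ⊗ₘ m) :=
    (memLp_fluxFun_comp_conj hp hu).integrable_mul (hw.sub hu)
  have h := integral_mono hi (hiw.sub hiu) fun a =>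
    fluxFun_mul_sub_le hp (nonlocalGrad u a) (nonlocalGrad w a)
  have hsub : ∫ a, (|nonlocalGrad w a| ^ p / p - |nonlocalGrad u a| ^ p / p) ∂(ν ⊗ₘ m) =
      (∫ a, |nonlocalGrad w a| ^ p ∂(ν ⊗ₘ m)) / p -
        (∫ a, |nonlocalGrad u a| ^ p ∂(ν ⊗ₘ m)) / p := by
    rw [integral_sub hiw hiu, integral_div, integral_div]
  simp only [Pi.sub_apply] at h
  rw [hsub] at h
  simp_rw [hgrad]
  have e (I : ℝ) : 1 / (2 * p) * I = 1 / 2 * (I / p) := by field_simp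
  rw [realEnergy, realEnergy, e, e]
  linarith

/-- Continuity of the flux along rays, tested against the direction of the ray. -/
lemma tendsto_integral_pFlux {p : ℝ} (hp : 1 < p) {u φ : X → ℝ}
    (hu : MemLp (nonlocalGrad u) (ENNReal.ofReal p) (ν ⊗ₘ m))
    (hφ : MemLp (nonlocalGrad φ) (ENNReal.ofReal p) (ν ⊗ₘ m)) :
    Filter.Tendsto (fun n : ℕ => ∫ a, pFlux p (u + (1 / ((n : ℝ) + 1)) • φ) a * nonlocalGrad φ a
      ∂(ν ⊗ₘ m)) Filter.atTop (nhds (∫ a, pFlux p u a * nonlocalGrad φ a ∂(ν ⊗ₘ m))) := by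
  have := holderConjugate_ofReal hp
  have hgrad (t : ℝ) (a : X × X) :
      nonlocalGrad (u + t • φ) a = nonlocalGrad u a + t * nonlocalGrad φ a := by
    simp only [nonlocalGrad, Pi.add_apply, Pi.smul_apply, smul_eq_mul]; ring
  simp_rw [pFlux_eq, hgrad]
  refine tendsto_integral_of_dominated_convergence
    (fun a => ‖fluxFun p (‖nonlocalGrad u a‖ + ‖nonlocalGrad φ a‖) * nonlocalGrad φ a‖)
    (fun n => ?_) ((memLp_fluxFun_comp_conj hp (hu.norm.add hφ.norm)).integrable_mul hφ).norm
    (fun n => ae_of_all _ fun a => ?_) (ae_of_all _ fun a => ?_)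
  · exact ((continuous_fluxFun hp).comp_aestronglyMeasurable
      (hu.1.add (hφ.1.const_mul _))).mul hφ.1
  · rw [norm_mul, norm_mul, Real.norm_eq_abs (fluxFun _ _), Real.norm_eq_abs (fluxFun _ _),
      abs_fluxFun hp, abs_fluxFun hp]
    gcongr ?_ * _
    refine Real.rpow_le_rpow (abs_nonneg _) ?_ (by linarith)
    rw [abs_of_nonneg (by positivity : 0 ≤ ‖nonlocalGrad u a‖ + ‖nonlocalGrad φ a‖)]
    refine (abs_add_le _ _).trans ?_
    rw [abs_mul]
    have ht : |1 / ((n : ℝ) + 1)| ≤ 1 := by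
      rw [abs_of_nonneg (by positivity), div_le_one (by positivity)]
      linarith [n.cast_nonneg (α := ℝ)]
    have := mul_le_mul_of_nonneg_right ht (abs_nonneg (nonlocalGrad φ a))
    simp only [Real.norm_eq_abs]
    linarith
  · refine Filter.Tendsto.mul_const _ (((continuous_fluxFun hp).tendsto _).comp ?_)
    simpa using (tendsto_one_div_add_atTop_nhds_zero_nat.mul_const
      (nonlocalGrad φ a)).const_add (nonlocalGrad u a)

end Energy

/-! ### The `p`-Laplacian on a reversible random walk space -/

section Reversible

variable {m : Kernel X X} [IsMarkovKernel m] {ν : Measure X} [SigmaFinite ν]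

lemma nonlocalDiv_pFlux_congr (hrev : m.IsReversible ν) (p : ℝ) {u w : X → ℝ} (h : u =ᵐ[ν] w) :
    nonlocalDiv m (pFlux p u) =ᵐ[ν] nonlocalDiv m (pFlux p w) := by
  filter_upwards [Measure.ae_ae_of_ae_compProd (nonlocalGrad_ae_eq hrev h)] with x hx
  rw [nonlocalDiv_of_antisymm (pFlux_swap p u), nonlocalDiv_of_antisymm (pFlux_swap p w)]
  refine integral_congr_ae (hx.mono fun y hy => ?_)
  simp only [pFlux_eq, hy]

lemma memLp_nonlocalDiv_pFlux {p r : ℝ} (hp : 1 < p) (hr : 1 ≤ r) {u : X → ℝ}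
    (hu : StronglyMeasurable u)
    (h : MemLp (nonlocalGrad u) (ENNReal.ofReal (r * (p - 1))) (ν ⊗ₘ m)) :
    MemLp (nonlocalDiv m (pFlux p u)) (ENNReal.ofReal r) ν :=
  memLp_nonlocalDiv (stronglyMeasurable_pFlux hp hu) (pFlux_swap p u) hr
    (memLp_fluxFun_comp hp h)

lemma memLp_nonlocalDiv_pFlux_conj {p : ℝ} (hp : 1 < p) {u : X → ℝ} (hu : StronglyMeasurable u)
    (h : MemLp (nonlocalGrad u) (ENNReal.ofReal p) (ν ⊗ₘ m)) :
    MemLp (nonlocalDiv m (pFlux p u)) (ENNReal.ofReal (p / (p - 1))) ν :=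
  memLp_nonlocalDiv_pFlux (r := p / (p - 1)) hp
    (Real.HolderConjugate.conjExponent hp).symm.lt.le hu
    (by rwa [div_mul_cancel₀ _ (by linarith : p - 1 ≠ 0)])

lemma pEnergy_congr (hrev : m.IsReversible ν) (p : ℝ) {u w : X → ℝ} (h : u =ᵐ[ν] w) :
    pEnergy p m ν u = pEnergy p m ν w := by
  unfold pEnergy
  rw [lintegral_congr_ae ((nonlocalGrad_ae_eq (m := m) hrev h).mono fun a ha => ?_)]
  simp only [ha]

/-- Accretivity of `-Δ_p`, tested with monotone functions of the difference. -/
lemma integral_nonlocalDiv_sub_mul_nonpos (hrev : m.IsReversible ν) {p : ℝ} (hp : 1 < p)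
    {u w : X → ℝ}
    (hu : MemLp (nonlocalGrad u) (ENNReal.ofReal p) (ν ⊗ₘ m))
    (hw : MemLp (nonlocalGrad w) (ENNReal.ofReal p) (ν ⊗ₘ m))
    (hud : MemLp (nonlocalDiv m (pFlux p u)) 2 ν) (hwd : MemLp (nonlocalDiv m (pFlux p w)) 2 ν)
    {g : ℝ → ℝ} (hg : Monotone g) (hg2 : MemLp (fun x => g (u x - w x)) 2 ν)
    (hgp : MemLp (fun x => g (u x - w x)) (ENNReal.ofReal p) ν) :
    ∫ x, (nonlocalDiv m (pFlux p u) x - nonlocalDiv m (pFlux p w) x) * g (u x - w x) ∂ν ≤ 0 := by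
  have := holderConjugate_ofReal hp
  have hzu := memLp_fluxFun_comp_conj hp hu
  have hzw := memLp_fluxFun_comp_conj hp hw
  have hgg := memLp_nonlocalGrad hrev hgp
  have hu' := integral_mul_nonlocalGrad hrev (pFlux_swap p u) hzu hgp
  have hw' := integral_mul_nonlocalGrad hrev (pFlux_swap p w) hzw hgp
  simp_rw [sub_mul]
  have hiu : Integrable (fun x => nonlocalDiv m (pFlux p u) x * g (u x - w x)) ν :=
    hud.integrable_mul hg2
  have hiw : Integrable (fun x => nonlocalDiv m (pFlux p w) x * g (u x - w x)) ν :=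
    hwd.integrable_mul hg2
  rw [integral_sub hiu hiw]
  have hnonneg : 0 ≤ ∫ a, (pFlux p u a * nonlocalGrad (fun x => g (u x - w x)) a -
      pFlux p w a * nonlocalGrad (fun x => g (u x - w x)) a) ∂(ν ⊗ₘ m) := by
    refine integral_nonneg fun a => ?_
    simp only [Pi.zero_apply]
    rw [← sub_mul]
    refine fluxFun_sub_mul_nonneg hp hg ?_
    simp only [nonlocalGrad]
    ring
  have hju : Integrable (fun a => pFlux p u a * nonlocalGrad (fun x => g (u x - w x)) a)
      (ν ⊗ₘ m) := hzu.integrable_mul hgg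
  have hjw : Integrable (fun a => pFlux p w a * nonlocalGrad (fun x => g (u x - w x)) a)
      (ν ⊗ₘ m) := hzw.integrable_mul hgg
  rw [integral_sub hju hjw] at hnonneg
  linarith

end Reversible

/-! ### Square integrability of the two Laplacians -/

/-- A function in `L^a` that differs from a square integrable one by a function in `L^b`, with
`b ≤ 2 ≤ a`, is square integrable: the exponent `a` controls its large values and the exponent
`b` its small ones. -/
lemma memLp_two_of_add {α : Type*} [MeasurableSpace α] {ν : Measure α} {a b : ℝ} (ha : 2 ≤ a)
    (hb0 : 0 < b) (hb : b ≤ 2) {f h : α → ℝ} (hf : MemLp f (ENNReal.ofReal a) ν)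
    (hh : MemLp h (ENNReal.ofReal b) ν) (hfh : MemLp (fun x => f x + h x) 2 ν) :
    MemLp f 2 ν := by
  have hm : Measurable fun s : ℝ => if 1 < |s| then s else 0 :=
    Measurable.ite (measurableSet_lt measurable_const measurable_norm) measurable_id
      measurable_const
  have h1 : MemLp (fun x => if 1 < |f x| then f x else 0) 2 ν := by
    have hmf : AEStronglyMeasurable (fun x => if 1 < |f x| then f x else 0) ν :=
      (hm.comp_aemeasurable hf.1.aemeasurable).aestronglyMeasurable
    rw [memLp_two_iff_integrable_sq hmf]
    refine (integrable_abs_rpow (by linarith) hf).mono (hmf.pow 2) (ae_of_all _ fun x => ?_)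
    rw [Real.norm_of_nonneg (sq_nonneg _),
      Real.norm_of_nonneg (Real.rpow_nonneg (abs_nonneg _) _)]
    split_ifs with hx
    · rw [← sq_abs, ← Real.rpow_two]
      exact Real.rpow_le_rpow_of_exponent_le hx.le ha
    · simpa using Real.rpow_nonneg (abs_nonneg _) _
  have h2 : MemLp (fun x => min |h x| 1) 2 ν := by
    have hmh : AEStronglyMeasurable (fun x => min |h x| 1) ν :=
      hh.1.norm.inf aestronglyMeasurable_const
    rw [memLp_two_iff_integrable_sq hmh]
    refine (integrable_abs_rpow hb0 hh).mono (hmh.pow 2) (ae_of_all _ fun x => ?_)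
    rw [Real.norm_of_nonneg (sq_nonneg _),
      Real.norm_of_nonneg (Real.rpow_nonneg (abs_nonneg _) _)]
    have h0 : 0 ≤ min |h x| 1 := le_min (abs_nonneg _) zero_le_one
    calc min |h x| 1 ^ 2 = min |h x| 1 ^ (2 : ℝ) := (Real.rpow_two _).symm
      _ ≤ min |h x| 1 ^ b := Real.rpow_le_rpow_of_exponent_ge_of_imp h0 (min_le_right _ _) hb
          fun _ h' => absurd h' two_ne_zero
      _ ≤ |h x| ^ b := Real.rpow_le_rpow h0 (min_le_left _ _) hb0.le
  refine ((hfh.norm.add h1.norm).add h2.norm).mono hf.1 (ae_of_all _ fun x => ?_)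
  refine le_trans ?_ (le_abs_self _)
  simp only [Pi.add_apply, Real.norm_eq_abs]
  have hmin := abs_nonneg (min |h x| 1)
  split_ifs with hx
  · have := abs_nonneg (f x + h x)
    linarith
  · rw [abs_zero, add_zero]
    rcases le_total |h x| 1 with hhx | hhx
    · rw [min_eq_left hhx, abs_abs]
      have := abs_sub (f x + h x) (h x)
      rwa [add_sub_cancel_right] at this
    · rw [min_eq_right hhx, abs_one]
      have := abs_nonneg (f x + h x)
      linarith [not_lt.1 hx]

/-! ### Two comparable measures -/

section Comparable

variable {ν₁ ν₂ : Measure X} [SigmaFinite ν₁] [SigmaFinite ν₂]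

lemma exists_le_smul_of_memLp_density (hac : ν₂ ≪ ν₁) (hbdd : MemLp (density ν₂ ν₁) ∞ ν₁) :
    ∃ C : ℝ≥0∞, C ≠ ∞ ∧ ν₂ ≤ C • ν₁ := by
  refine ⟨eLpNormEssSup (density ν₂ ν₁) ν₁, ?_, ?_⟩
  · simpa using hbdd.2.ne
  · conv_lhs => rw [← Measure.withDensity_rnDeriv_eq ν₂ ν₁ hac]
    rw [← withDensity_const]
    refine withDensity_mono ?_
    filter_upwards [ae_le_eLpNormEssSup (f := density ν₂ ν₁) (μ := ν₁),
      ν₂.rnDeriv_lt_top ν₁] with x hx hx'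
    rwa [density, Real.enorm_eq_ofReal ENNReal.toReal_nonneg, ENNReal.ofReal_toReal hx'.ne] at hx

lemma exists_le_smul_of_le_density (hac : ν₂ ≪ ν₁)
    (hpos : ∃ c : ℝ, 0 < c ∧ ∀ᵐ x ∂ν₁, c ≤ density ν₂ ν₁ x) :
    ∃ C : ℝ≥0∞, C ≠ ∞ ∧ ν₁ ≤ C • ν₂ := by
  obtain ⟨c, hc, hle⟩ := hpos
  have h0 : ENNReal.ofReal c ≠ 0 := by simpa using hc
  have h : ENNReal.ofReal c • ν₁ ≤ ν₂ := by
    conv_rhs => rw [← Measure.withDensity_rnDeriv_eq ν₂ ν₁ hac]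
    rw [← withDensity_const]
    refine withDensity_mono ?_
    filter_upwards [hle] with x hx
    exact ENNReal.ofReal_le_of_le_toReal hx
  refine ⟨(ENNReal.ofReal c)⁻¹, ENNReal.inv_ne_top.2 h0, ?_⟩
  calc ν₁ = (ENNReal.ofReal c)⁻¹ • ENNReal.ofReal c • ν₁ := by
        rw [smul_smul, ENNReal.inv_mul_cancel h0 ENNReal.ofReal_ne_top, one_smul]
    _ ≤ (ENNReal.ofReal c)⁻¹ • ν₂ := by gcongr

lemma integral_density_mul (hac : ν₂ ≪ ν₁) (f : X → ℝ) :
    ∫ x, density ν₂ ν₁ x * f x ∂ν₁ = ∫ x, f x ∂ν₂ :=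
  integral_toReal_rnDeriv_mul hac

lemma integrable_density_mul_iff (hac : ν₂ ≪ ν₁) {f : X → ℝ} :
    Integrable (fun x => density ν₂ ν₁ x * f x) ν₁ ↔ Integrable f ν₂ :=
  integrable_toReal_rnDeriv_mul_iff hac

lemma integrable_neg_sub_density_mul (hac : ν₂ ≪ ν₁) {d₁ d₂ φ : X → ℝ}
    (h₁ : Integrable (fun x => d₁ x * φ x) ν₁) (h₂ : Integrable (fun x => d₂ x * φ x) ν₂) :
    Integrable (fun x => (-d₁ x - density ν₂ ν₁ x * d₂ x) * φ x) ν₁ := by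
  refine (h₁.neg.sub ((integrable_density_mul_iff hac).2 h₂)).congr (ae_of_all _ fun x => ?_)
  simp only [Pi.sub_apply, Pi.neg_apply]
  ring

lemma integral_neg_sub_density_mul (hac : ν₂ ≪ ν₁) {d₁ d₂ φ : X → ℝ}
    (h₁ : Integrable (fun x => d₁ x * φ x) ν₁) (h₂ : Integrable (fun x => d₂ x * φ x) ν₂) :
    ∫ x, (-d₁ x - density ν₂ ν₁ x * d₂ x) * φ x ∂ν₁ =
      -∫ x, d₁ x * φ x ∂ν₁ - ∫ x, d₂ x * φ x ∂ν₂ := by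
  have h₁' : Integrable (fun x => -(d₁ x * φ x)) ν₁ := h₁.neg
  rw [← integral_density_mul hac, ← integral_neg,
    ← integral_sub h₁' ((integrable_density_mul_iff hac).2 h₂)]
  refine integral_congr_ae (ae_of_all _ fun x => ?_)
  ring

end Comparable

section Operator

variable {m₁ m₂ : Kernel X X} {ν₁ ν₂ : Measure X}

/-! ### Complete accretivity from monotone test functions, and convexity along rays -/

/-- An operator satisfying `∫ g(u₁ - u₂) (v₁ - v₂) ≥ 0` for all bounded monotone `g` vanishing
near the origin is completely accretive: `j(s + r t) ≥ j(s) + r g(s) t` for a subgradient `g`. -/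
lemma completelyAccretive_of_integral_nonneg {A : Set (Lp ℝ 2 ν₁ × Lp ℝ 2 ν₁)}
    (h : ∀ a ∈ A, ∀ b ∈ A, ∀ f g : ℝ → ℝ, IsTruncatedSubgradient f g →
      0 ≤ ∫ x, g (a.1 x - b.1 x) * (a.2 x - b.2 x) ∂ν₁) :
    CompletelyAccretive A := by
  intro a ha b hb r hr
  refine JDominated.of_truncatedSubgradient (Lp.stronglyMeasurable _).measurable.aemeasurable
    fun f g hfg => ?_
  obtain ⟨C, hC⟩ := hfg.bounded
  obtain ⟨δ, hδ, hgδ⟩ := hfg.vanishing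
  have hf0 (w : X → ℝ) (hw : MemLp w 2 ν₁) : Integrable (fun x => f (w x)) ν₁ := by
    have hg := memLp_comp_of_vanishing hw hfg.monotone.measurable hC hδ hgδ 2
    refine (hg.integrable_mul hw).mono
      (hfg.continuous.comp_aestronglyMeasurable hw.1) (ae_of_all _ fun x => ?_)
    rw [Real.norm_of_nonneg (hfg.nonneg _)]
    exact (hfg.le_mul_self _).trans (le_abs_self _)
  have hU := Lp.memLp (a.1 - b.1)
  have hV := Lp.memLp (a.2 - b.2)
  have hW := Lp.memLp (a.1 - b.1 + r • (a.2 - b.2))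
  have hg := memLp_comp_of_vanishing hU hfg.monotone.measurable hC hδ hgδ 2
  have hgV : Integrable (fun x => g ((a.1 - b.1 : Lp ℝ 2 ν₁) x) * (a.2 - b.2 : Lp ℝ 2 ν₁) x) ν₁ :=
    hg.integrable_mul hV
  rw [← ofReal_integral_eq_lintegral_ofReal (hf0 _ hU) (ae_of_all _ fun x => hfg.nonneg _),
    ← ofReal_integral_eq_lintegral_ofReal (hf0 _ hW) (ae_of_all _ fun x => hfg.nonneg _)]
  refine ENNReal.ofReal_le_ofReal ?_
  have hpair : 0 ≤ ∫ x, g ((a.1 - b.1 : Lp ℝ 2 ν₁) x) * (a.2 - b.2 : Lp ℝ 2 ν₁) x ∂ν₁ := by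
    refine (h a ha b hb f g hfg).trans_eq (integral_congr_ae ?_)
    filter_upwards [Lp.coeFn_sub a.1 b.1, Lp.coeFn_sub a.2 b.2] with x h₁ h₂
    simp only [h₁, h₂, Pi.sub_apply]
  have hmono : ∫ x, (f ((a.1 - b.1 : Lp ℝ 2 ν₁) x) +
      r * (g ((a.1 - b.1 : Lp ℝ 2 ν₁) x) * (a.2 - b.2 : Lp ℝ 2 ν₁) x)) ∂ν₁ ≤
      ∫ x, f ((a.1 - b.1 + r • (a.2 - b.2) : Lp ℝ 2 ν₁) x) ∂ν₁ := by
    refine integral_mono_ae ((hf0 _ hU).add (hgV.const_mul r)) (hf0 _ hW) ?_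
    filter_upwards [Lp.coeFn_add (a.1 - b.1) (r • (a.2 - b.2)),
      Lp.coeFn_smul r (a.2 - b.2)] with x h₁ h₂
    rw [h₁, Pi.add_apply, h₂, Pi.smul_apply, smul_eq_mul]
    refine le_trans (le_of_eq ?_) (hfg.subgradient ((a.1 - b.1 : Lp ℝ 2 ν₁) x) _)
    ring
  rw [integral_add (hf0 _ hU) (hgV.const_mul r), integral_const_mul] at hmono
  linarith [mul_nonneg hr.le hpair]

lemma inner_eq_integral_mul {α : Type*} [MeasurableSpace α] {ν : Measure α} (f g : Lp ℝ 2 ν) :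
    inner ℝ f g = ∫ x, f x * g x ∂ν := by
  rw [L2.inner_def]
  refine integral_congr_ae (ae_of_all _ fun x => ?_)
  simp [mul_comm]

/-- Convexity of the energy along a ray, with the slope at the far end. -/
lemma realEnergy_add_smul_sub_le {m : Kernel X X} {ν : Measure X} {p : ℝ} (hp : 1 < p)
    {u φ : X → ℝ} (hu : MemLp (nonlocalGrad u) (ENNReal.ofReal p) (ν ⊗ₘ m))
    (hφ : MemLp (nonlocalGrad φ) (ENNReal.ofReal p) (ν ⊗ₘ m)) (t : ℝ) :
    MemLp (nonlocalGrad (u + t • φ)) (ENNReal.ofReal p) (ν ⊗ₘ m) ∧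
    realEnergy p m ν (u + t • φ) - realEnergy p m ν u ≤
      t * (1 / 2 * ∫ a, pFlux p (u + t • φ) a * nonlocalGrad φ a ∂(ν ⊗ₘ m)) := by
  have hgrad : nonlocalGrad (u + t • φ) = nonlocalGrad u + t • nonlocalGrad φ := by
    funext a
    simp only [nonlocalGrad, Pi.add_apply, Pi.smul_apply, smul_eq_mul]
    ring
  have hw : MemLp (nonlocalGrad (u + t • φ)) (ENNReal.ofReal p) (ν ⊗ₘ m) :=
    hgrad ▸ hu.add (hφ.const_smul t)
  refine ⟨hw, ?_⟩
  have h := integral_pFlux_mul_le hp hw hu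
  have hsub : ∀ a, nonlocalGrad (u - (u + t • φ)) a = -t * nonlocalGrad φ a := fun a => by
    simp only [nonlocalGrad, Pi.sub_apply, Pi.add_apply, Pi.smul_apply, smul_eq_mul]
    ring
  simp_rw [hsub, mul_left_comm _ (-t), integral_const_mul] at h
  linarith

/-! ### The operator `-Δ_q - μ Δ_p` -/

lemma pEnergy_add_pEnergy_eq {q p : ℝ} (hq : 1 < q) (hp : 1 < p) {w : X → ℝ}
    (hw₁ : MemLp (nonlocalGrad w) (ENNReal.ofReal q) (ν₁ ⊗ₘ m₁))
    (hw₂ : MemLp (nonlocalGrad w) (ENNReal.ofReal p) (ν₂ ⊗ₘ m₂)) :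
    pEnergy q m₁ ν₁ w + pEnergy p m₂ ν₂ w =
      ((realEnergy q m₁ ν₁ w + realEnergy p m₂ ν₂ w : ℝ) : EReal) := by
  rw [pEnergy_eq hq hw₁, pEnergy_eq hp hw₂, EReal.coe_add]

lemma memLp_nonlocalGrad_of_add_ne_top {q p : ℝ} (hq : 1 < q) (hp : 1 < p) {w : X → ℝ}
    (hw : StronglyMeasurable w) (h : pEnergy q m₁ ν₁ w + pEnergy p m₂ ν₂ w ≠ ⊤) :
    MemLp (nonlocalGrad w) (ENNReal.ofReal q) (ν₁ ⊗ₘ m₁) ∧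
      MemLp (nonlocalGrad w) (ENNReal.ofReal p) (ν₂ ⊗ₘ m₂) := by
  have hbot {r : ℝ} {m : Kernel X X} {ν : Measure X} : pEnergy r m ν w ≠ ⊥ := fun h' => by
    simpa [h'] using pEnergy_nonneg r m ν w
  constructor
  · refine memLp_nonlocalGrad_of_pEnergy hq hw fun h' => h ?_
    rw [h', EReal.top_add_of_ne_bot hbot]
  · refine memLp_nonlocalGrad_of_pEnergy hp hw fun h' => h ?_
    rw [h', EReal.add_top_of_ne_bot hbot]

/-- Membership in `-Δ_q - μ Δ_p` in terms of one representative of `u`. -/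
lemma mem_qpOperator_iff [IsMarkovKernel m₂] [SigmaFinite ν₂]
    (hrev₂ : m₂.IsReversible ν₂) (hac' : ν₁ ≪ ν₂)
    (hmem : ∀ {f : X → ℝ} {r : ℝ≥0∞}, MemLp f r ν₁ ↔ MemLp f r ν₂)
    {q p : ℝ} {u v : Lp ℝ 2 ν₁} :
    (u, v) ∈ qpOperator q p m₁ m₂ ν₁ ν₂ ↔
      MemLp (nonlocalGrad u) (ENNReal.ofReal q) (ν₁ ⊗ₘ m₁) ∧
      MemLp (nonlocalGrad u) (ENNReal.ofReal p) (ν₂ ⊗ₘ m₂) ∧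
      MemLp (nonlocalDiv m₁ (pFlux q u)) 2 ν₁ ∧ MemLp (nonlocalDiv m₂ (pFlux p u)) 2 ν₂ ∧
      v =ᵐ[ν₁] fun x => -nonlocalDiv m₁ (pFlux q u) x -
        density ν₂ ν₁ x * nonlocalDiv m₂ (pFlux p u) x := by
  constructor
  · rintro ⟨v₁, ⟨hu₁, hv₁⟩, u₂, v₂, huu, ⟨hu₂, hv₂⟩, hv⟩
    dsimp only at hu₁ hv₁ huu hu₂ hv₂ hv
    have hv₂' := hv₂.trans (nonlocalDiv_pFlux_congr hrev₂ p huu)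
    refine ⟨hu₁, hu₂.ae_eq (nonlocalGrad_ae_eq hrev₂ huu), (Lp.memLp v₁).ae_eq hv₁,
      (Lp.memLp v₂).ae_eq hv₂', ?_⟩
    filter_upwards [hv, hv₁, hac'.ae_le hv₂'] with x h h₁ h₂
    rw [h, h₁, h₂]
  · rintro ⟨hu₁, hu₂, hd₁, hd₂, hv⟩
    have hu : MemLp u 2 ν₂ := hmem.1 (Lp.memLp u)
    have huu := hu.coeFn_toLp
    refine ⟨hd₁.toLp _, ⟨hu₁, hd₁.coeFn_toLp⟩, hu.toLp _, hd₂.toLp _, huu,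
      ⟨hu₂.ae_eq (nonlocalGrad_ae_eq hrev₂ huu).symm, ?_⟩, ?_⟩
    · exact hd₂.coeFn_toLp.trans (nonlocalDiv_pFlux_congr hrev₂ p huu).symm
    · filter_upwards [hv, hd₁.coeFn_toLp, hac'.ae_le hd₂.coeFn_toLp] with x h h₁ h₂
      rw [h, h₁, h₂]

variable [IsMarkovKernel m₁] [IsMarkovKernel m₂] [SigmaFinite ν₁] [SigmaFinite ν₂]

/-! ### Complete accretivity -/

theorem completelyAccretive_qpOperator (hrev₁ : m₁.IsReversible ν₁) (hrev₂ : m₂.IsReversible ν₂)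
    (hac : ν₂ ≪ ν₁) (hac' : ν₁ ≪ ν₂)
    (hmem : ∀ {f : X → ℝ} {r : ℝ≥0∞}, MemLp f r ν₁ ↔ MemLp f r ν₂)
    {q p : ℝ} (hq : 1 < q) (hp : 1 < p) :
    CompletelyAccretive (qpOperator q p m₁ m₂ ν₁ ν₂) := by
  refine completelyAccretive_of_integral_nonneg ?_
  rintro ⟨u, v⟩ ha ⟨w, k⟩ hb f g hfg
  obtain ⟨hu₁, hu₂, hdu₁, hdu₂, hv⟩ := (mem_qpOperator_iff hrev₂ hac' hmem).1 ha
  obtain ⟨hw₁, hw₂, hdw₁, hdw₂, hk⟩ := (mem_qpOperator_iff hrev₂ hac' hmem).1 hb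
  obtain ⟨C, hC⟩ := hfg.bounded
  obtain ⟨δ, hδ, hgδ⟩ := hfg.vanishing
  have hg (r : ℝ≥0∞) : MemLp (fun x => g (u x - w x)) r ν₁ :=
    memLp_comp_of_vanishing ((Lp.memLp u).sub (Lp.memLp w)) hfg.monotone.measurable hC hδ hgδ r
  have h₁ := integral_nonlocalDiv_sub_mul_nonpos hrev₁ hq hu₁ hw₁ hdu₁ hdw₁ hfg.monotone
    (hg 2) (hg _)
  have h₂ := integral_nonlocalDiv_sub_mul_nonpos hrev₂ hp hu₂ hw₂ hdu₂ hdw₂ hfg.monotone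
    (hmem.1 (hg 2)) (hmem.1 (hg _))
  have hsplit := integral_neg_sub_density_mul hac ((hdu₁.sub hdw₁).integrable_mul (hg 2))
    ((hdu₂.sub hdw₂).integrable_mul (hmem.1 (hg 2)))
  simp only [Pi.sub_apply] at hsplit
  have : ∫ x, g (u x - w x) * (v x - k x) ∂ν₁ =
      ∫ x, (-(nonlocalDiv m₁ (pFlux q u) x - nonlocalDiv m₁ (pFlux q w) x) - density ν₂ ν₁ x *
        (nonlocalDiv m₂ (pFlux p u) x - nonlocalDiv m₂ (pFlux p w) x)) * g (u x - w x) ∂ν₁ := by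
    refine integral_congr_ae ?_
    filter_upwards [hv, hk] with x hx hx'
    rw [hx, hx']
    ring
  simp only [this, hsplit]
  linarith

/-! ### Density of the domain -/

/-- Integrable simple functions belong to the domain, as all their fluxes are in `L²`. -/
theorem dense_operatorDomain_qpOperator (hrev₁ : m₁.IsReversible ν₁)
    (hrev₂ : m₂.IsReversible ν₂) (hac' : ν₁ ≪ ν₂)
    (hmem : ∀ {f : X → ℝ} {r : ℝ≥0∞}, MemLp f r ν₁ ↔ MemLp f r ν₂)
    (hbdd : MemLp (density ν₂ ν₁) ∞ ν₁) {q p : ℝ} (hq : 1 < q) (hp : 1 < p) :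
    Dense (operatorDomain (qpOperator q p m₁ m₂ ν₁ ν₂)) := by
  refine (Lp.simpleFunc.dense (E := ℝ) (p := 2) (μ := ν₁) ENNReal.ofNat_ne_top).mono ?_
  intro u hu
  have hu₁ : ∀ r : ℝ, 0 < r → MemLp u (ENNReal.ofReal r) ν₁ := by
    intro r hr
    have h2 := Lp.simpleFunc.memLp (⟨u, hu⟩ : Lp.simpleFunc ℝ 2 ν₁)
    rw [SimpleFunc.memLp_iff two_ne_zero ENNReal.ofNat_ne_top] at h2
    exact ((SimpleFunc.memLp_iff (by simpa using hr) ENNReal.ofReal_ne_top).2 h2).ae_eq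
      (Lp.simpleFunc.toSimpleFunc_eq_toFun (⟨u, hu⟩ : Lp.simpleFunc ℝ 2 ν₁))
  have hd₁ : MemLp (nonlocalDiv m₁ (pFlux q u)) 2 ν₁ := by
    have := memLp_nonlocalDiv_pFlux hq one_le_two (Lp.stronglyMeasurable u)
      (memLp_nonlocalGrad hrev₁ (hu₁ (2 * (q - 1)) (by linarith)))
    simpa using this
  have hd₂ : MemLp (nonlocalDiv m₂ (pFlux p u)) 2 ν₂ := by
    have := memLp_nonlocalDiv_pFlux hp one_le_two (Lp.stronglyMeasurable u)
      (memLp_nonlocalGrad hrev₂ (hmem.1 (hu₁ (2 * (p - 1)) (by linarith))))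
    simpa using this
  have hv : MemLp (fun x => -nonlocalDiv m₁ (pFlux q u) x -
      density ν₂ ν₁ x * nonlocalDiv m₂ (pFlux p u) x) 2 ν₁ :=
    hd₁.neg.sub ((hmem.2 hd₂).mul hbdd)
  exact ⟨hv.toLp _, (mem_qpOperator_iff hrev₂ hac' hmem).2
    ⟨memLp_nonlocalGrad hrev₁ (hu₁ q (by linarith)),
      memLp_nonlocalGrad hrev₂ (hmem.1 (hu₁ p (by linarith))), hd₁, hd₂, hv.coeFn_toLp⟩⟩

/-! ### The subdifferential of the sum of the energies -/

/-- The subgradient inequalities of the two energies, integrated by parts against `w - u`. -/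
theorem qpOperator_subset_subdifferential (hrev₁ : m₁.IsReversible ν₁)
    (hrev₂ : m₂.IsReversible ν₂) (hac : ν₂ ≪ ν₁) (hac' : ν₁ ≪ ν₂)
    (hmem : ∀ {f : X → ℝ} {r : ℝ≥0∞}, MemLp f r ν₁ ↔ MemLp f r ν₂)
    {q p : ℝ} (hq : 1 < q) (hp : 1 < p) :
    qpOperator q p m₁ m₂ ν₁ ν₂ ⊆ subdifferential (fun u : Lp ℝ 2 ν₁ =>
        pEnergy q m₁ ν₁ u + pEnergy p m₂ ν₂ u) := by
  rintro ⟨u, v⟩ hA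
  obtain ⟨hu₁, hu₂, hd₁, hd₂, hv⟩ := (mem_qpOperator_iff hrev₂ hac' hmem).1 hA
  have := holderConjugate_ofReal hq
  have := holderConjugate_ofReal hp
  refine ⟨?_, fun w => ?_⟩
  · simp only [pEnergy_add_pEnergy_eq hq hp hu₁ hu₂]
    exact EReal.coe_ne_top _
  by_cases hw : pEnergy q m₁ ν₁ w + pEnergy p m₂ ν₂ w = ⊤
  · simp only [hw]
    exact le_top
  obtain ⟨hw₁, hw₂⟩ := memLp_nonlocalGrad_of_add_ne_top hq hp (Lp.stronglyMeasurable w) hw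
  simp only [pEnergy_add_pEnergy_eq hq hp hu₁ hu₂, pEnergy_add_pEnergy_eq hq hp hw₁ hw₂]
  rw [← EReal.coe_add, EReal.coe_le_coe_iff]
  have hgrad : nonlocalGrad ((w : X → ℝ) - (u : X → ℝ)) = nonlocalGrad w - nonlocalGrad u := by
    funext a
    simp only [nonlocalGrad, Pi.sub_apply]
    ring
  have hφ : MemLp ((w : X → ℝ) - (u : X → ℝ)) 2 ν₁ := (Lp.memLp w).sub (Lp.memLp u)
  have h₁ := integral_pFlux_mul_le hq hu₁ hw₁
  have h₂ := integral_pFlux_mul_le hp hu₂ hw₂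
  rw [integral_mul_nonlocalGrad_of_memLp_two hrev₁ (pFlux_swap q u)
    (memLp_fluxFun_comp_conj hq hu₁) hd₁ hφ (hgrad ▸ hw₁.sub hu₁)] at h₁
  rw [integral_mul_nonlocalGrad_of_memLp_two hrev₂ (pFlux_swap p u)
    (memLp_fluxFun_comp_conj hp hu₂) hd₂ (hmem.1 hφ) (hgrad ▸ hw₂.sub hu₂)] at h₂
  have hinner : inner ℝ v (w - u) =
      -∫ x, nonlocalDiv m₁ (pFlux q u) x * ((w : X → ℝ) - (u : X → ℝ)) x ∂ν₁ -
      ∫ x, nonlocalDiv m₂ (pFlux p u) x * ((w : X → ℝ) - (u : X → ℝ)) x ∂ν₂ := by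
    rw [← integral_neg_sub_density_mul hac (hd₁.integrable_mul hφ)
      (hd₂.integrable_mul (hmem.1 hφ)), inner_eq_integral_mul]
    refine integral_congr_ae ?_
    filter_upwards [hv, Lp.coeFn_sub w u] with x hx hx'
    rw [hx, hx']
  linarith

/-- The variational inequality satisfied by a subgradient, tested with a function that is in all
the relevant `L^r` spaces. -/
lemma integral_mul_le_of_mem_subdifferential (hrev₁ : m₁.IsReversible ν₁)
    (hrev₂ : m₂.IsReversible ν₂) (hac : ν₂ ≪ ν₁) {q p : ℝ} (hq : 1 < q) (hp : 1 < p)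
    {u v : Lp ℝ 2 ν₁} (huv : (u, v) ∈ subdifferential (fun u : Lp ℝ 2 ν₁ =>
        pEnergy q m₁ ν₁ u + pEnergy p m₂ ν₂ u))
    {φ : X → ℝ} (hφ : MemLp φ 2 ν₁) (hφ₁ : MemLp φ (ENNReal.ofReal q) ν₁)
    (hφ₂ : MemLp φ (ENNReal.ofReal p) ν₂) :
    ∫ x, v x * φ x ∂ν₁ ≤ -∫ x, nonlocalDiv m₁ (pFlux q u) x * φ x ∂ν₁ -
      ∫ x, nonlocalDiv m₂ (pFlux p u) x * φ x ∂ν₂ := by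
  obtain ⟨htop, hsub⟩ := huv
  dsimp only at htop hsub
  obtain ⟨hu₁, hu₂⟩ := memLp_nonlocalGrad_of_add_ne_top hq hp (Lp.stronglyMeasurable u) htop
  have := holderConjugate_ofReal hq
  have := holderConjugate_ofReal hp
  have hg₁ := memLp_nonlocalGrad hrev₁ hφ₁
  have hg₂ := memLp_nonlocalGrad hrev₂ hφ₂
  have hlim := ((tendsto_integral_pFlux hq hu₁ hg₁).const_mul (1 / 2 : ℝ)).add
    ((tendsto_integral_pFlux hp hu₂ hg₂).const_mul (1 / 2 : ℝ))
  rw [integral_mul_nonlocalGrad hrev₁ (pFlux_swap q u) (memLp_fluxFun_comp_conj hq hu₁) hφ₁,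
    integral_mul_nonlocalGrad hrev₂ (pFlux_swap p u) (memLp_fluxFun_comp_conj hp hu₂) hφ₂,
    ← sub_eq_add_neg] at hlim
  refine ge_of_tendsto' hlim fun n => ?_
  have ht : (0 : ℝ) < 1 / ((n : ℝ) + 1) := by positivity
  set t : ℝ := 1 / ((n : ℝ) + 1)
  obtain ⟨hw₁, he₁⟩ := realEnergy_add_smul_sub_le hq hu₁ hg₁ t
  obtain ⟨hw₂, he₂⟩ := realEnergy_add_smul_sub_le hp hu₂ hg₂ t
  have hcoe : (u + t • hφ.toLp φ : Lp ℝ 2 ν₁) =ᵐ[ν₁] (u : X → ℝ) + t • φ := by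
    filter_upwards [Lp.coeFn_add u (t • hφ.toLp φ), Lp.coeFn_smul t (hφ.toLp φ),
      hφ.coeFn_toLp] with x h₁ h₂ h₃
    rw [h₁, Pi.add_apply, h₂, Pi.smul_apply, h₃, Pi.add_apply, Pi.smul_apply]
  have h := hsub (u + t • hφ.toLp φ)
  rw [pEnergy_congr hrev₁ q hcoe, pEnergy_congr hrev₂ p (hac.ae_le hcoe),
    pEnergy_add_pEnergy_eq hq hp hu₁ hu₂, pEnergy_add_pEnergy_eq hq hp hw₁ hw₂, ← EReal.coe_add,
    EReal.coe_le_coe_iff, add_sub_cancel_left, inner_smul_right, inner_eq_integral_mul] at h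
  have hint : ∫ x, v x * (hφ.toLp φ : Lp ℝ 2 ν₁) x ∂ν₁ = ∫ x, v x * φ x ∂ν₁ :=
    integral_congr_ae (hφ.coeFn_toLp.mono fun x hx => by simp only [hx])
  rw [hint] at h
  refine le_of_mul_le_mul_left ?_ ht
  linarith

/-- A subgradient of the sum splits into the two Laplacians. Only the sum `Δ_q u + μ Δ_p u` is
known to be square integrable from the Euler-Lagrange equation; Jensen's inequality gives
`Δ_q u ∈ L^{q'}` with `q' ≥ 2` and `Δ_p u ∈ L^{p'}`, which makes each summand square integrable
when the measure is finite or `p' ≤ 2`. -/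
theorem subdifferential_subset_qpOperator (hrev₁ : m₁.IsReversible ν₁)
    (hrev₂ : m₂.IsReversible ν₂) (hac : ν₂ ≪ ν₁) (hac' : ν₁ ≪ ν₂)
    (hmem : ∀ {f : X → ℝ} {r : ℝ≥0∞}, MemLp f r ν₁ ↔ MemLp f r ν₂)
    (hbdd : MemLp (density ν₂ ν₁) ∞ ν₁)
    (hpos : ∃ c : ℝ, 0 < c ∧ ∀ᵐ x ∂ν₁, c ≤ density ν₂ ν₁ x)
    {q p : ℝ} (hq : 1 < q) (hp : 1 < p) (hq2 : q ≤ 2) (hcase : ν₁ Set.univ < ∞ ∨ 2 ≤ p) :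
    subdifferential (fun u : Lp ℝ 2 ν₁ => pEnergy q m₁ ν₁ u + pEnergy p m₂ ν₂ u) ⊆
      qpOperator q p m₁ m₂ ν₁ ν₂ := by
  rintro ⟨u, v⟩ huv
  obtain ⟨hu₁, hu₂⟩ := memLp_nonlocalGrad_of_add_ne_top hq hp (Lp.stronglyMeasurable u) huv.1
  have := holderConjugate_ofReal hq
  have := holderConjugate_ofReal hp
  have hd₁ := memLp_nonlocalDiv_pFlux_conj hq (Lp.stronglyMeasurable u) hu₁
  have hd₂ := memLp_nonlocalDiv_pFlux_conj hp (Lp.stronglyMeasurable u) hu₂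
  set d₁ := nonlocalDiv m₁ (pFlux q u)
  set d₂ := nonlocalDiv m₂ (pFlux p u)
  have hind (s : Set X) (hs : MeasurableSet s) (hνs : ν₁ s < ∞) (r : ℝ≥0∞) :
      MemLp (s.indicator fun _ => (1 : ℝ)) r ν₁ :=
    memLp_indicator_const r hs 1 (Or.inr hνs.ne)
  have hmul (s : Set X) (f : X → ℝ) :
      (fun x => f x * s.indicator (fun _ => (1 : ℝ)) x) = s.indicator f := by
    funext x
    by_cases hx : x ∈ s <;> simp [hx]
  have hi₁ (s : Set X) (hs : MeasurableSet s) (hνs : ν₁ s < ∞) :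
      Integrable (fun x => d₁ x * s.indicator (fun _ => (1 : ℝ)) x) ν₁ :=
    hd₁.integrable_mul (hind s hs hνs (ENNReal.ofReal q))
  have hi₂ (s : Set X) (hs : MeasurableSet s) (hνs : ν₁ s < ∞) :
      Integrable (fun x => d₂ x * s.indicator (fun _ => (1 : ℝ)) x) ν₂ :=
    hd₂.integrable_mul (hmem.1 (hind s hs hνs (ENNReal.ofReal p)))
  -- The Euler-Lagrange equation, obtained from the test functions `1_s` and `-1_s`.
  have hv : v =ᵐ[ν₁] fun x => -d₁ x - density ν₂ ν₁ x * d₂ x := by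
    refine ae_eq_of_forall_setIntegral_eq_of_sigmaFinite (fun s hs hνs => ?_)
      (fun s hs hνs => ?_) fun s hs hνs => ?_
    · rw [← integrable_indicator_iff hs, ← hmul]
      exact (Lp.memLp v).integrable_mul (hind s hs hνs 2)
    · rw [← integrable_indicator_iff hs, ← hmul]
      exact integrable_neg_sub_density_mul hac (hi₁ s hs hνs) (hi₂ s hs hνs)
    · rw [← integral_indicator hs, ← integral_indicator hs, ← hmul s v,
        ← hmul s fun x => -d₁ x - density ν₂ ν₁ x * d₂ x,
        integral_neg_sub_density_mul hac (hi₁ s hs hνs) (hi₂ s hs hνs)]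
      have h₁ := integral_mul_le_of_mem_subdifferential hrev₁ hrev₂ hac hq hp huv
        (hind s hs hνs 2) (hind s hs hνs _) (hmem.1 (hind s hs hνs _))
      have h₂ := integral_mul_le_of_mem_subdifferential hrev₁ hrev₂ hac hq hp huv
        (hind s hs hνs 2).neg (hind s hs hνs _).neg (hmem.1 (hind s hs hνs _)).neg
      simp only [Pi.neg_apply, mul_neg, integral_neg] at h₂
      exact le_antisymm h₁ (by linarith)
  have hmu (r : ℝ≥0∞) (h : MemLp d₂ r ν₂) : MemLp (fun x => density ν₂ ν₁ x * d₂ x) r ν₁ :=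
    (hmem.2 h).mul hbdd
  have hsum : MemLp (fun x => d₁ x + density ν₂ ν₁ x * d₂ x) 2 ν₁ := by
    refine (Lp.memLp v).neg.ae_eq (hv.mono fun x hx => ?_)
    rw [Pi.neg_apply, hx]
    ring
  have hq' : 2 ≤ q / (q - 1) := by
    rw [le_div_iff₀ (by linarith)]
    linarith
  have hd₁2 : MemLp d₁ 2 ν₁ := by
    rcases hcase with hfin | hp2
    · have : IsFiniteMeasure ν₁ := ⟨hfin⟩
      refine hd₁.mono_exponent ?_
      simpa using ENNReal.ofReal_le_ofReal hq'
    · refine memLp_two_of_add hq' (div_pos (by linarith) (by linarith)) ?_ hd₁ (hmu _ hd₂) hsum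
      rw [div_le_iff₀ (by linarith)]
      linarith
  have hd₂2 : MemLp d₂ 2 ν₂ := by
    obtain ⟨c, hc, hle⟩ := hpos
    refine hmem.1 (((hsum.sub hd₁2).const_mul c⁻¹).mono (hmem.2 hd₂).1 ?_)
    filter_upwards [hle] with x hx
    rw [Pi.sub_apply, add_sub_cancel_left, norm_mul, norm_mul, norm_inv, Real.norm_of_nonneg hc.le,
      Real.norm_of_nonneg (hc.le.trans hx), inv_mul_eq_div, le_div_iff₀ hc, mul_comm]
    gcongr
  exact (mem_qpOperator_iff hrev₂ hac' hmem).2 ⟨hu₁, hu₂, hd₁2, hd₂2, hv⟩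

end Operator

end RandomWalk

theorem theorem3p12 {X : Type*} [MeasurableSpace X] [MeasurableSpace.CountablyGenerated X]
    (m₁ m₂ : Kernel X X) [IsMarkovKernel m₁] [IsMarkovKernel m₂]
    (ν₁ ν₂ : Measure X) [SigmaFinite ν₁] [SigmaFinite ν₂]
    (hrev₁ : m₁.IsReversible ν₁) (hrev₂ : m₂.IsReversible ν₂)
    (hac : ν₂ ≪ ν₁)
    (hbdd : MemLp (RandomWalk.density ν₂ ν₁) ∞ ν₁)
    (hpos : ∃ c : ℝ, 0 < c ∧ ∀ᵐ x ∂ν₁, c ≤ RandomWalk.density ν₂ ν₁ x)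
    (q p : ℝ) (hq : 1 < q) (hp : 1 < p)
    (hcase : (ν₁ Set.univ < ∞ ∧ q ≤ 2) ∨
      (ν₁ Set.univ = ∞ ∧ q ≤ p / (p - 1) ∧ p / (p - 1) ≤ 2 ∧ 2 ≤ p)) :
    RandomWalk.subdifferential (fun u : Lp ℝ 2 ν₁ =>
        RandomWalk.pEnergy q m₁ ν₁ u + RandomWalk.pEnergy p m₂ ν₂ u) =
      RandomWalk.qpOperator q p m₁ m₂ ν₁ ν₂ ∧
    RandomWalk.CompletelyAccretive (RandomWalk.qpOperator q p m₁ m₂ ν₁ ν₂) ∧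
    Dense (RandomWalk.operatorDomain (RandomWalk.qpOperator q p m₁ m₂ ν₁ ν₂)) := by
  obtain ⟨C, hC, hle⟩ := RandomWalk.exists_le_smul_of_memLp_density hac hbdd
  obtain ⟨C', hC', hle'⟩ := RandomWalk.exists_le_smul_of_le_density hac hpos
  have hac' : ν₁ ≪ ν₂ := Measure.absolutelyContinuous_of_le_smul hle'
  have hmem {f : X → ℝ} {r : ℝ≥0∞} : MemLp f r ν₁ ↔ MemLp f r ν₂ :=
    ⟨fun h => h.of_measure_le_smul hC hle, fun h => h.of_measure_le_smul hC' hle'⟩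
  have hq2 : q ≤ 2 := hcase.elim And.right fun h => h.2.1.trans h.2.2.1
  exact ⟨(RandomWalk.subdifferential_subset_qpOperator hrev₁ hrev₂ hac hac' hmem hbdd hpos hq hp
      hq2 (hcase.imp And.left fun h => h.2.2.2)).antisymm
      (RandomWalk.qpOperator_subset_subdifferential hrev₁ hrev₂ hac hac' hmem hq hp),
    RandomWalk.completelyAccretive_qpOperator hrev₁ hrev₂ hac hac' hmem hq hp,
    RandomWalk.dense_operatorDomain_qpOperator hrev₁ hrev₂ hac' hmem hbdd hq hp⟩
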